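/- **Theorem (Janssen's representation).** Let $d\ge 1$. For $x,\omega\in\mathbb R^d$ put $T_xf(t)=f(t-x)$, $M_\omega f(t)=e^{2\pi i\langle\omega,t\rangle}f(t)$, $\tau(x,\omega)=M_\omega T_x$, and write $\langle f,h\rangle=\int_{\mathbb R^d}f\,\overline h\,dx$. Let $S_0(\mathbb R^d)$ (Feichtinger's algebra) be the set of all $g\in L^2(\mathbb R^d)$ for which $(t,\omega)\mapsto\langle g,\tau(t,\omega)g\rangle$ belongs to $L^1(\mathbb R^{2d})$. For $1\le p,q\le\infty$ let $W(L^p,\ell^q)$ be the Wiener amalgam space of measurable functions with finite norm $\|f\|_{W(L^p,\ell^q)}=\big(\sum_{k\in\mathbb Z^d}\|f\cdot\chi_{k+[0,1)^d}\|_p^q\big)^{1/q}$ (a supremum over $k$ if $q=\infty$). Let $g,\gamma\in S_0(\mathbb R^d)$ with $\langle\gamma,g\rangle\ne0$, let $a,b>0$ and $1\le p,q\le\infty$. (i) There is exactly one bounded operator $S_{a,b;g,\gamma}$ on $W(L^p,\ell^q)$ such that $$S_{a,b;g,\gamma}f=\frac{(ab)^d}{\langle\gamma,g\rangle}\sum_{n,m\in\mathbb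 Z^d}\langle f,\tau(na,mb)g\rangle\,\tau(na,mb)\gamma\qquad (f\in W(L^p,\ell^q)),$$ where the series converges unconditionally in the weak sense, i.e. after pairing with any $h\in S_0(\mathbb R^d)$. If $p=q=2$, so that $W(L^p,\ell^q)=L^2(\mathbb R^d)$, the series also converges unconditionally in the $L^2$ norm. (ii) This operator has the representations $$S_{a,b;g,\gamma}=\frac1{\langle\gamma,g\rangle}\sum_{l,n\in\mathbb Z^d}\langle\gamma,M_{l/a}T_{n/b}g\rangle\,M_{l/a}T_{n/b}=\frac1{\langle\gamma,g\rangle}\sum_{k,n\in\mathbb Z^d}\langle\gamma,T_{k/b}M_{n/a}g\rangle\,T_{k/b}M_{n/a},$$ and both series converge absolutely in the operator norm of $W(L^p,\ell^q)$. -/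

import Mathlib

open MeasureTheory
open scoped ENNReal ComplexConjugate RealInnerProductSpace

noncomputable section

namespace GaborJanssen

variable {d : ℕ}

/-- Translation `(T_x f)(t) = f (t - x)`. -/
def translateFn (x : EuclideanSpace ℝ (Fin d)) (f : EuclideanSpace ℝ (Fin d) → ℂ) :
    EuclideanSpace ℝ (Fin d) → ℂ :=
  fun t => f (t - x)

/-- The character `t ↦ e^{2 π i ⟨ω, t⟩}`. -/
def character (ω : EuclideanSpace ℝ (Fin d)) : EuclideanSpace ℝ (Fin d) → ℂ :=
  fun t => Complex.exp (2 * (Real.pi : ℂ) * Complex.I * ((⟪ω, t⟫ : ℝ) : ℂ))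

/-- Modulation `(M_ω f)(t) = e^{2 π i ⟨ω, t⟩} f(t)`. -/
def modulateFn (ω : EuclideanSpace ℝ (Fin d)) (f : EuclideanSpace ℝ (Fin d) → ℂ) :
    EuclideanSpace ℝ (Fin d) → ℂ :=
  fun t => character ω t * f t

/-- The time-frequency shift `τ(t, ω) g (x) = g (x - t) e^{2 π i ⟨x, ω⟩}`. -/
def tfShift (t ω : EuclideanSpace ℝ (Fin d)) (g : EuclideanSpace ℝ (Fin d) → ℂ) :
    EuclideanSpace ℝ (Fin d) → ℂ :=
  modulateFn ω (translateFn t g)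

/-- The pairing `⟨f, h⟩ = ∫ f(x) conj (h(x)) dx`. -/
def pairing (f h : EuclideanSpace ℝ (Fin d) → ℂ) : ℂ :=
  ∫ x, f x * conj (h x)

/-- The windowed Fourier transform `(F_g f)(t, ω) = ⟨f, τ(t, ω) g⟩`. -/
def windowedFourier (g f : EuclideanSpace ℝ (Fin d) → ℂ)
    (z : EuclideanSpace ℝ (Fin d) × EuclideanSpace ℝ (Fin d)) : ℂ :=
  pairing f (tfShift z.1 z.2 g)

/-- Feichtinger's algebra `S_0(ℝ^d)`: the `g ∈ L²(ℝ^d)` with `F_g g ∈ L¹(ℝ^{2d})`. -/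
def MemS0 (g : EuclideanSpace ℝ (Fin d) → ℂ) : Prop :=
  MemLp g 2 volume ∧ Integrable (windowedFourier g g) volume

/-- The point `c k` of the lattice `c ℤ^d`. -/
def latticePoint (c : ℝ) (k : Fin d → ℤ) : EuclideanSpace ℝ (Fin d) :=
  WithLp.toLp 2 fun i => c * (k i : ℝ)

/-! ### The Wiener amalgam spaces -/

/-- The cube `k + [0,1)^d`. -/
def cube (k : Fin d → ℤ) : Set (EuclideanSpace ℝ (Fin d)) :=
  {x | ∀ i, (k i : ℝ) ≤ x i ∧ x i < (k i : ℝ) + 1}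

/-- The norm `(∑_{k ∈ ℤ^d} ‖f · T_k χ_{[0,1)^d}‖_p ^ q)^{1/q}` (a supremum over `k` if `q = ∞`),
with values in `[0, ∞]`: the `ℓ^q` norm, that is, the `L^q` norm for the counting measure, of the
sequence of local `L^p` norms. -/
def amalgamENorm (p q : ℝ≥0∞) (f : EuclideanSpace ℝ (Fin d) → ℂ) : ℝ≥0∞ :=
  eLpNorm (fun k : Fin d → ℤ => eLpNorm ((cube k).indicator f) p volume) q Measure.count

theorem measurableSet_cube (k : Fin d → ℤ) : MeasurableSet (cube k) := by
  have : cube k = ⋂ i, {x : EuclideanSpace ℝ (Fin d) | (k i : ℝ) ≤ x i ∧ x i < (k i : ℝ) + 1} := by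
    ext x; simp [cube]
  rw [this]
  refine MeasurableSet.iInter fun i => ?_
  have hm : Measurable fun x : EuclideanSpace ℝ (Fin d) => x i := by fun_prop
  exact (measurableSet_le measurable_const hm).inter (measurableSet_lt hm measurable_const)

theorem exists_mem_cube (x : EuclideanSpace ℝ (Fin d)) : ∃ k, x ∈ cube k :=
  ⟨fun i => ⌊x i⌋, fun _ => ⟨Int.floor_le _, Int.lt_floor_add_one _⟩⟩

theorem amalgamENorm_congr {p q : ℝ≥0∞} {f g : EuclideanSpace ℝ (Fin d) → ℂ}
    (h : f =ᵐ[volume] g) : amalgamENorm p q f = amalgamENorm p q g := by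
  unfold amalgamENorm
  congr 1
  funext k
  exact eLpNorm_congr_ae (h.mono fun x hx => by simp [Set.indicator, hx])

theorem amalgamENorm_zero {p q : ℝ≥0∞} :
    amalgamENorm p q (0 : EuclideanSpace ℝ (Fin d) → ℂ) = 0 := by
  have : (fun k : Fin d → ℤ =>
      eLpNorm ((cube k).indicator (0 : EuclideanSpace ℝ (Fin d) → ℂ)) p volume) = 0 := by
    funext k
    simp
  rw [amalgamENorm, this, eLpNorm_zero]

theorem amalgamENorm_neg {p q : ℝ≥0∞} (f : EuclideanSpace ℝ (Fin d) → ℂ) :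
    amalgamENorm p q (-f) = amalgamENorm p q f := by
  unfold amalgamENorm
  congr 1
  funext k
  rw [Set.indicator_neg', eLpNorm_neg]

theorem amalgamENorm_add_le {p q : ℝ≥0∞} (hp : 1 ≤ p) (hq : 1 ≤ q)
    {f g : EuclideanSpace ℝ (Fin d) → ℂ} (hf : AEStronglyMeasurable f volume)
    (hg : AEStronglyMeasurable g volume) :
    amalgamENorm p q (f + g) ≤ amalgamENorm p q f + amalgamENorm p q g := by
  unfold amalgamENorm
  refine le_trans (eLpNorm_mono_enorm fun k => ?_) (eLpNorm_add_le
    (measurable_of_countable _).aestronglyMeasurable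
    (measurable_of_countable _).aestronglyMeasurable hq)
  simp only [enorm_eq_self, Pi.add_apply]
  rw [Set.indicator_add']
  exact eLpNorm_add_le (hf.indicator (measurableSet_cube k))
    (hg.indicator (measurableSet_cube k)) hp

theorem amalgamENorm_smul_le {p q : ℝ≥0∞} (c : ℂ) (f : EuclideanSpace ℝ (Fin d) → ℂ) :
    amalgamENorm p q (c • f) ≤ ‖c‖ₑ * amalgamENorm p q f := by
  unfold amalgamENorm
  refine eLpNorm_le_nnreal_smul_eLpNorm_of_ae_le_mul' (Filter.Eventually.of_forall fun k => ?_) q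
  simp only [enorm_eq_self]
  have h : (cube k).indicator (c • f) = c • (cube k).indicator f :=
    Set.indicator_const_smul (cube k) c f
  rw [h, eLpNorm_const_smul]
  rfl

theorem ae_eq_zero_of_amalgamENorm_eq_zero {p q : ℝ≥0∞} (hp : 1 ≤ p) (hq : 1 ≤ q)
    {f : EuclideanSpace ℝ (Fin d) → ℂ} (hf : AEStronglyMeasurable f volume)
    (h : amalgamENorm p q f = 0) : f =ᵐ[volume] 0 := by
  unfold amalgamENorm at h
  rw [eLpNorm_eq_zero_iff (measurable_of_countable _).aestronglyMeasurable
    (by positivity)] at h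
  have h' : ∀ k : Fin d → ℤ, (cube k).indicator f =ᵐ[volume] 0 := by
    intro k
    have hk := (Measure.ae_count_iff.1 h) k
    exact (eLpNorm_eq_zero_iff (hf.indicator (measurableSet_cube k)) (by positivity)).1 hk
  filter_upwards [ae_all_iff.2 h'] with x hx
  obtain ⟨k, hk⟩ := exists_mem_cube x
  have := hx k
  rwa [Set.indicator_of_mem hk] at this

theorem amalgamENorm_modulate {p q : ℝ≥0∞} (ω : EuclideanSpace ℝ (Fin d))
    (f : EuclideanSpace ℝ (Fin d) → ℂ) :
    amalgamENorm p q (modulateFn ω f) = amalgamENorm p q f := by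
  unfold amalgamENorm
  congr 1
  funext k
  refine eLpNorm_congr_enorm_ae (Filter.Eventually.of_forall fun x => ?_)
  have hx : ‖character ω x‖ₑ = 1 := by
    have : ‖character ω x‖ = 1 := by
      rw [character, show 2 * (Real.pi : ℂ) * Complex.I * ((⟪ω, x⟫ : ℝ) : ℂ)
        = ((2 * Real.pi * ⟪ω, x⟫ : ℝ) : ℂ) * Complex.I by push_cast; ring]
      exact Complex.norm_exp_ofReal_mul_I _
    rw [← ofReal_norm, this, ENNReal.ofReal_one]
  by_cases hk : x ∈ cube k
  · simp [hk, modulateFn, hx]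
  · simp [hk]

theorem continuous_character (ω : EuclideanSpace ℝ (Fin d)) : Continuous (character ω) := by
  unfold character
  fun_prop

theorem aestronglyMeasurable_translate (x : EuclideanSpace ℝ (Fin d))
    {f : EuclideanSpace ℝ (Fin d) → ℂ} (hf : AEStronglyMeasurable f volume) :
    AEStronglyMeasurable (translateFn x f) volume :=
  hf.comp_measurePreserving (measurePreserving_sub_right volume x)

theorem aestronglyMeasurable_modulate (ω : EuclideanSpace ℝ (Fin d))
    {f : EuclideanSpace ℝ (Fin d) → ℂ} (hf : AEStronglyMeasurable f volume) :
    AEStronglyMeasurable (modulateFn ω f) volume :=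
  (continuous_character ω).aestronglyMeasurable.mul hf

/-- The Wiener amalgam space `W(L^p, ℓ^q)`, as a space of a.e. classes of measurable functions. -/
def amalgam (d : ℕ) (p q : ℝ≥0∞) [hp : Fact (1 ≤ p)] [hq : Fact (1 ≤ q)] :
    Submodule ℂ (EuclideanSpace ℝ (Fin d) →ₘ[volume] ℂ) where
  carrier := {f | amalgamENorm p q f < ∞}
  zero_mem' := by
    change amalgamENorm p q _ < ∞
    rw [amalgamENorm_congr AEEqFun.coeFn_zero, amalgamENorm_zero]
    exact ENNReal.zero_lt_top
  add_mem' := by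
    intro f g hf hg
    change amalgamENorm p q _ < ∞
    rw [amalgamENorm_congr (AEEqFun.coeFn_add f g)]
    exact (amalgamENorm_add_le hp.out hq.out f.aestronglyMeasurable
      g.aestronglyMeasurable).trans_lt (ENNReal.add_lt_top.2 ⟨hf, hg⟩)
  smul_mem' := by
    intro c f hf
    change amalgamENorm p q _ < ∞
    rw [amalgamENorm_congr (AEEqFun.coeFn_smul c f)]
    exact (amalgamENorm_smul_le c _).trans_lt (ENNReal.mul_lt_top enorm_lt_top hf)

variable {p q : ℝ≥0∞} [hp : Fact (1 ≤ p)] [hq : Fact (1 ≤ q)]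

instance : NormedAddCommGroup (amalgam d p q) :=
  AddGroupNorm.toNormedAddCommGroup
    { toFun := fun f => (amalgamENorm p q (f : EuclideanSpace ℝ (Fin d) →ₘ[volume] ℂ)).toReal
      map_zero' := by
        rw [Submodule.coe_zero, amalgamENorm_congr AEEqFun.coeFn_zero, amalgamENorm_zero]
        rfl
      add_le' := by
        intro f g
        rw [Submodule.coe_add, amalgamENorm_congr (AEEqFun.coeFn_add _ _),
          ← ENNReal.toReal_add f.2.ne g.2.ne]
        exact ENNReal.toReal_mono (ENNReal.add_lt_top.2 ⟨f.2, g.2⟩).ne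
          (amalgamENorm_add_le hp.out hq.out (AEEqFun.aestronglyMeasurable _)
            (AEEqFun.aestronglyMeasurable _))
      neg' := by
        intro f
        rw [Submodule.coe_neg, amalgamENorm_congr (AEEqFun.coeFn_neg _), amalgamENorm_neg]
      eq_zero_of_map_eq_zero' := by
        intro f hf
        rcases (ENNReal.toReal_eq_zero_iff _).1 hf with h | h
        · refine Subtype.ext (AEEqFun.ext ?_)
          exact (ae_eq_zero_of_amalgamENorm_eq_zero hp.out hq.out
            (AEEqFun.aestronglyMeasurable _) h).trans AEEqFun.coeFn_zero.symm
        · exact absurd h f.2.ne }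

theorem norm_def (f : amalgam d p q) :
    ‖f‖ = (amalgamENorm p q (f : EuclideanSpace ℝ (Fin d) →ₘ[volume] ℂ)).toReal := rfl

instance : NormedSpace ℂ (amalgam d p q) where
  norm_smul_le c f := by
    rw [norm_def, norm_def, Submodule.coe_smul, amalgamENorm_congr (AEEqFun.coeFn_smul _ _),
      ← toReal_enorm c, ← ENNReal.toReal_mul]
    exact ENNReal.toReal_mono (ENNReal.mul_lt_top enorm_lt_top f.2).ne (amalgamENorm_smul_le c _)

/-! ### Translations and modulations as bounded operators on the amalgam spaces -/

theorem amalgamENorm_translate_le (x : EuclideanSpace ℝ (Fin d))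
    {f : EuclideanSpace ℝ (Fin d) → ℂ} (hf : AEStronglyMeasurable f volume) :
    amalgamENorm p q (translateFn x f) ≤ 2 ^ d * amalgamENorm p q f := by
  classical
  have hcube : ∀ (k : Fin d → ℤ), eLpNorm ((cube k).indicator (translateFn x f)) p volume
      ≤ ∑ j : Fin d → Fin 2, eLpNorm ((cube
        (k + fun i => ⌊-x i⌋ + ((j i : ℕ) : ℤ))).indicator f) p volume := by
    intro k
    let D : Set (EuclideanSpace ℝ (Fin d)) := {y | y + x ∈ cube k}
    have hD : MeasurableSet D := (measurableSet_cube k).preimage (measurable_add_const x)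
    have h1 : (cube k).indicator (translateFn x f) = (D.indicator f) ∘ fun t => t - x := by
      funext t
      simp [Set.indicator, D, translateFn]
    rw [h1, eLpNorm_comp_measurePreserving (hf.indicator hD) (measurePreserving_sub_right volume x)]
    refine le_trans (eLpNorm_mono_enorm (g := fun y => ∑ j : Fin d → Fin 2,
      ‖(cube (k + fun i => ⌊-x i⌋ + ((j i : ℕ) : ℤ))).indicator f y‖ₑ) fun y => ?_) ?_
    · by_cases hy : y ∈ D
      · have hfl : ∀ i, ∃ j : Fin 2, ((k i + (⌊-x i⌋ + ((j : ℕ) : ℤ)) : ℤ) : ℝ) ≤ y i ∧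
            y i < ((k i + (⌊-x i⌋ + ((j : ℕ) : ℤ)) : ℤ) : ℝ) + 1 := by
          intro i
          have hi := hy i
          simp only [PiLp.add_apply] at hi
          have h2 := Int.floor_le (-x i)
          have h3 := Int.lt_floor_add_one (-x i)
          by_cases hc : y i < (k i : ℝ) + ⌊-x i⌋ + 1
          · refine ⟨0, ?_, ?_⟩
            · push_cast
              simp only [Fin.val_zero, Nat.cast_zero]
              linarith [hi.1]
            · push_cast
              simp only [Fin.val_zero, Nat.cast_zero]
              linarith
          · refine ⟨1, ?_, ?_⟩
            · push_cast
              simp only [Fin.val_one, Nat.cast_one]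
              linarith
            · push_cast
              simp only [Fin.val_one, Nat.cast_one]
              linarith [hi.2]
        choose j hj using hfl
        have hmem : y ∈ cube (k + fun i => ⌊-x i⌋ + ((j i : ℕ) : ℤ)) := fun i => by
          simpa using hj i
        rw [Set.indicator_of_mem hy, enorm_eq_self]
        refine le_trans (le_of_eq ?_) (Finset.single_le_sum
          (f := fun j : Fin d → Fin 2 =>
            ‖(cube (k + fun i => ⌊-x i⌋ + ((j i : ℕ) : ℤ))).indicator f y‖ₑ)
          (fun _ _ => zero_le) (Finset.mem_univ j))
        simp only [Set.indicator_of_mem hmem]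
      · simp [hy]
    · have hsum := eLpNorm_sum_le (μ := (volume : Measure (EuclideanSpace ℝ (Fin d)))) (p := p)
        (s := Finset.univ) (f := fun (j : Fin d → Fin 2) y =>
        ‖(cube (k + fun i => ⌊-x i⌋ + ((j i : ℕ) : ℤ))).indicator f y‖ₑ)
        (fun j _ => (hf.indicator (measurableSet_cube _)).enorm.aestronglyMeasurable) hp.out
      simp only [eLpNorm_enorm] at hsum
      refine le_trans (le_of_eq ?_) hsum
      congr 1
      funext y
      simp
  unfold amalgamENorm
  refine le_trans (eLpNorm_mono_enorm (g := ∑ j : Fin d → Fin 2, fun k : Fin d → ℤ =>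
    eLpNorm ((cube (k + fun i => ⌊-x i⌋ + ((j i : ℕ) : ℤ))).indicator f) p volume)
    fun k => ?_) ?_
  · simpa using hcube k
  · refine le_trans (eLpNorm_sum_le
      (fun j _ => (measurable_of_countable _).aestronglyMeasurable) hq.out) ?_
    have hj : ∀ j : Fin d → Fin 2, eLpNorm (fun k : Fin d → ℤ =>
        eLpNorm ((cube (k + fun i => ⌊-x i⌋ + ((j i : ℕ) : ℤ))).indicator f) p volume)
          q Measure.count
        = eLpNorm (fun k : Fin d → ℤ => eLpNorm ((cube k).indicator f) p volume)
          q Measure.count := by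
      intro j
      exact eLpNorm_comp_measurePreserving
        (g := fun k : Fin d → ℤ => eLpNorm ((cube k).indicator f) p volume)
        (measurable_of_countable _).aestronglyMeasurable
        (measurePreserving_add_right Measure.count fun i => ⌊-x i⌋ + ((j i : ℕ) : ℤ))
    simp [hj]

/-- The translation operator `T_x` on `W(L^p, ℓ^q)`. -/
def translationOp (p q : ℝ≥0∞) [hp : Fact (1 ≤ p)] [hq : Fact (1 ≤ q)]
    (x : EuclideanSpace ℝ (Fin d)) : amalgam d p q →L[ℂ] amalgam d p q :=
  LinearMap.mkContinuous
    { toFun := fun f =>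
        ⟨AEEqFun.mk (translateFn x (f : EuclideanSpace ℝ (Fin d) →ₘ[volume] ℂ))
          (aestronglyMeasurable_translate x (AEEqFun.aestronglyMeasurable _)), by
          change amalgamENorm p q _ < ∞
          rw [amalgamENorm_congr (AEEqFun.coeFn_mk _ _)]
          exact (amalgamENorm_translate_le x (AEEqFun.aestronglyMeasurable _)).trans_lt
            (ENNReal.mul_lt_top (by simp) f.2)⟩
      map_add' := by
        intro f g
        refine Subtype.ext (AEEqFun.mk_eq_mk.2 ?_)
        have h := (measurePreserving_sub_right volume x).quasiMeasurePreserving.ae_eq_comp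
          (AEEqFun.coeFn_add (f : EuclideanSpace ℝ (Fin d) →ₘ[volume] ℂ) g)
        exact h
      map_smul' := by
        intro c f
        refine Subtype.ext (AEEqFun.mk_eq_mk.2 ?_)
        have h := (measurePreserving_sub_right volume x).quasiMeasurePreserving.ae_eq_comp
          (AEEqFun.coeFn_smul c (f : EuclideanSpace ℝ (Fin d) →ₘ[volume] ℂ))
        exact h }
    (2 ^ d) (by
      intro f
      rw [norm_def, norm_def]
      have h := amalgamENorm_translate_le (p := p) (q := q) x
        (f : EuclideanSpace ℝ (Fin d) →ₘ[volume] ℂ).aestronglyMeasurable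
      have h2 := ENNReal.toReal_mono (ENNReal.mul_lt_top (by simp) f.2).ne h
      rw [ENNReal.toReal_mul, ENNReal.toReal_pow] at h2
      simp only [LinearMap.coe_mk, AddHom.coe_mk]
      rw [amalgamENorm_congr (AEEqFun.coeFn_mk _ _)]
      simpa using h2)

/-- The modulation operator `M_ω` on `W(L^p, ℓ^q)`. -/
def modulationOp (p q : ℝ≥0∞) [hp : Fact (1 ≤ p)] [hq : Fact (1 ≤ q)]
    (ω : EuclideanSpace ℝ (Fin d)) : amalgam d p q →L[ℂ] amalgam d p q :=
  LinearMap.mkContinuous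
    { toFun := fun f =>
        ⟨AEEqFun.mk (modulateFn ω (f : EuclideanSpace ℝ (Fin d) →ₘ[volume] ℂ))
          (aestronglyMeasurable_modulate ω (AEEqFun.aestronglyMeasurable _)), by
          change amalgamENorm p q _ < ∞
          rw [amalgamENorm_congr (AEEqFun.coeFn_mk _ _), amalgamENorm_modulate]
          exact f.2⟩
      map_add' := by
        intro f g
        refine Subtype.ext (AEEqFun.mk_eq_mk.2 ?_)
        filter_upwards [AEEqFun.coeFn_add (f : EuclideanSpace ℝ (Fin d) →ₘ[volume] ℂ) g] with t ht
        change character ω t * ((f : EuclideanSpace ℝ (Fin d) →ₘ[volume] ℂ) +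
          (g : EuclideanSpace ℝ (Fin d) →ₘ[volume] ℂ) : EuclideanSpace ℝ (Fin d) →ₘ[volume] ℂ) t
          = character ω t * _ + character ω t * _
        rw [ht, Pi.add_apply, mul_add]
      map_smul' := by
        intro c f
        refine Subtype.ext (AEEqFun.mk_eq_mk.2 ?_)
        filter_upwards [AEEqFun.coeFn_smul c (f : EuclideanSpace ℝ (Fin d) →ₘ[volume] ℂ)] with t ht
        change character ω t * (c • (f : EuclideanSpace ℝ (Fin d) →ₘ[volume] ℂ) :
          EuclideanSpace ℝ (Fin d) →ₘ[volume] ℂ) t = c * (character ω t * _)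
        rw [ht, Pi.smul_apply, smul_eq_mul, mul_left_comm] }
    1 (by
      intro f
      rw [norm_def, norm_def]
      simp only [LinearMap.coe_mk, AddHom.coe_mk]
      rw [amalgamENorm_congr (AEEqFun.coeFn_mk _ _), amalgamENorm_modulate, one_mul])

/-! ### The Gabor frame operator -/

/-- The function underlying an element of `W(L^p, ℓ^q)`. -/
abbrev toFn (f : amalgam d p q) : EuclideanSpace ℝ (Fin d) → ℂ :=
  (f : EuclideanSpace ℝ (Fin d) →ₘ[volume] ℂ)

/-- The bounded operator `S` on `W(L^p, ℓ^q)` is given by the Gabor series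
`S f = (ab)^d / ⟨γ, g⟩ * ∑_{n, m ∈ ℤ^d} ⟨f, τ(na, mb) g⟩ τ(na, mb) γ`, the series being
unconditionally convergent in the weak sense, against all functions of `S_0(ℝ^d)`. -/
def IsGaborFrameOperator (a b : ℝ) (g γ : EuclideanSpace ℝ (Fin d) → ℂ)
    (S : amalgam d p q →L[ℂ] amalgam d p q) : Prop :=
  ∀ (f : amalgam d p q) (h : EuclideanSpace ℝ (Fin d) → ℂ), MemS0 h →
    HasSum (fun nm : (Fin d → ℤ) × (Fin d → ℤ) =>
        (((a * b) ^ d : ℝ) : ℂ) / pairing γ g *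
          (pairing (toFn f) (tfShift (latticePoint a nm.1) (latticePoint b nm.2) g) *
            pairing (tfShift (latticePoint a nm.1) (latticePoint b nm.2) γ) h))
      (pairing (toFn (S f)) h)

open Classical in
/-- The Gabor frame operator `S_{a,b;g,γ}` on `W(L^p, ℓ^q)`: the bounded operator given by the
Gabor series (and `0` if there is none). -/
def gaborFrameOperator (p q : ℝ≥0∞) [hp : Fact (1 ≤ p)] [hq : Fact (1 ≤ q)] (a b : ℝ)
    (g γ : EuclideanSpace ℝ (Fin d) → ℂ) : amalgam d p q →L[ℂ] amalgam d p q :=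
  if h : ∃ S : amalgam d p q →L[ℂ] amalgam d p q, IsGaborFrameOperator a b g γ S
  then h.choose else 0

end GaborJanssen

end

open GaborJanssen

open scoped FourierTransform

noncomputable section

namespace GaborJanssen

/-! ### Local suprema and functions with integrable local suprema -/

section LocalSup

/-! The theorem reduces to the fundamental identity of Gabor analysis, `hasSum_gabor`: for `g`, `γ`,
`h` in `S_0` and `f` in `W(L^1, ℓ^∞)`, the lattice sum of `F_g f · conj (F_γ h)` equals `(ab)^{-d}`
times the sum over `k`, `l` of `⟨γ, T_{k/b} M_{l/a} g⟩ ⟨T_{k/b} M_{l/a} f, h⟩`. For fixed `n`, the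
sum over the modulations `mb` is a Parseval identity for periodizations with step `1/b`
(`tsum_modulation_eq`). After exchanging sums, for fixed `k`, the sum over the translations `na` is
an `aℤ^d`-periodization of `γ(· + k/b) conj g`, and Poisson summation turns it into a series over
`l/a` with Janssen's coefficients (`tsum_translation_eq`).

Convergence rests on two facts about `S_0`: its functions lie in `W(L^∞, ℓ^1)`
(`MemS0.exists_supIntegrable_bound`), and so do their windowed Fourier transforms on phase space
(`MemS0.supIntegrable_windowedFourier`). Both come from comparison with a Gaussian. Fourier
inversion gives the first; Moyal's identity with shifted windows bounds the transform by a
convolution, which gives the second. Membership in `W(L^∞, ℓ^1)` is encoded by integrable local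
suprema, which survive convolution with `L^1` and bound sums over separated points.

Janssen's coefficients are therefore summable. Translations and modulations are uniformly bounded on
the complete space `W(L^p, ℓ^q)`, so Janssen's series converges absolutely to an operator. The
fundamental identity shows that this operator has the required weak Gabor expansion, so existence
follows from the representation itself. Uniqueness holds because `S_0` separates points. The two
forms of the series agree term by term. In `L²`, Schur's test on the Gram matrices of the two Gabor
systems gives unconditional norm convergence. -/

/-- The supremum of `F` over the open ball of radius `R` around `z`. -/
def localSup {X : Type*} [PseudoMetricSpace X] (R : ℝ) (F : X → ℝ≥0∞) (z : X) : ℝ≥0∞ :=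
  ⨆ y ∈ Metric.ball z R, F y

theorem le_localSup {X : Type*} [PseudoMetricSpace X] {R : ℝ} {F : X → ℝ≥0∞} {y z : X}
    (h : dist y z < R) : F y ≤ localSup R F z :=
  le_iSup₂ (f := fun y (_ : y ∈ Metric.ball z R) => F y) y h

theorem localSup_le {X : Type*} [PseudoMetricSpace X] {R : ℝ} {F : X → ℝ≥0∞} {z : X} {C : ℝ≥0∞}
    (h : ∀ y, dist y z < R → F y ≤ C) : localSup R F z ≤ C :=
  iSup₂_le h

theorem localSup_mono {X : Type*} [PseudoMetricSpace X] {R : ℝ} {F G : X → ℝ≥0∞}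
    (h : ∀ y, F y ≤ G y) (z : X) : localSup R F z ≤ localSup R G z :=
  iSup₂_mono fun y _ => h y

theorem localSup_localSup_le {X : Type*} [PseudoMetricSpace X] (R R' : ℝ) (F : X → ℝ≥0∞) (z : X) :
    localSup R (localSup R' F) z ≤ localSup (R + R') F z := by
  refine localSup_le fun y hy => localSup_le fun w hw => le_localSup ?_
  linarith [dist_triangle w y z]

/-- The superlevel sets are open thickenings of superlevel sets of `F`, so `F` itself may be
arbitrary. This is why local suprema are taken over open balls. -/
theorem measurable_localSup {X : Type*} [PseudoMetricSpace X] [MeasurableSpace X]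
    [OpensMeasurableSpace X] (R : ℝ) (F : X → ℝ≥0∞) : Measurable (localSup R F) := by
  refine measurable_of_Ioi fun c => IsOpen.measurableSet ?_
  have : localSup R F ⁻¹' Set.Ioi c = Metric.thickening R {y | c < F y} := by
    ext z
    simp only [localSup, Set.mem_preimage, Set.mem_Ioi, lt_iSup_iff, Metric.mem_ball,
      Metric.mem_thickening_iff, Set.mem_ofPred_eq]
    constructor
    · rintro ⟨y, h1, h2⟩
      exact ⟨y, h2, by rwa [dist_comm]⟩
    · rintro ⟨y, h1, h2⟩
      exact ⟨y, by rwa [dist_comm], h1⟩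
  rw [this]
  exact Metric.isOpen_thickening

/-- All local suprema of `F` are integrable. For continuous `F` this says `F ∈ W(L^∞, ℓ^1)`. -/
def SupIntegrable {X : Type*} [PseudoMetricSpace X] [MeasureSpace X] (F : X → ℝ≥0∞) : Prop :=
  ∀ R : ℝ, ∫⁻ z, localSup R F z < ∞

variable {X : Type*} [NormedAddCommGroup X] [MeasureSpace X]

theorem SupIntegrable.mono {F G : X → ℝ≥0∞} (hG : SupIntegrable G) (h : ∀ y, F y ≤ G y) :
    SupIntegrable F :=
  fun R => (lintegral_mono (localSup_mono h)).trans_lt (hG R)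

theorem SupIntegrable.local_sup {F : X → ℝ≥0∞} (hF : SupIntegrable F) (R : ℝ) :
    SupIntegrable (localSup R F) :=
  fun R' => (lintegral_mono (localSup_localSup_le R' R F)).trans_lt (hF _)

theorem SupIntegrable.lintegral_lt_top {F : X → ℝ≥0∞} (hF : SupIntegrable F) :
    ∫⁻ z, F z < ∞ :=
  (lintegral_mono fun z => le_localSup (by simp : dist z z < 1)).trans_lt (hF 1)

theorem SupIntegrable.const_mul [BorelSpace X] {F : X → ℝ≥0∞} (hF : SupIntegrable F) {C : ℝ≥0∞} (hC : C ≠ ∞) :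
    SupIntegrable fun z => C * F z := by
  intro R
  have : ∫⁻ z, C * localSup R F z < ∞ := by
    rw [lintegral_const_mul _ (measurable_localSup R F)]
    exact ENNReal.mul_lt_top hC.lt_top (hF R)
  refine (lintegral_mono fun z => localSup_le fun y hy => ?_).trans_lt this
  gcongr
  exact le_localSup hy

variable [BorelSpace X] [(volume : Measure X).IsAddHaarMeasure]

/-- Convolution with an integrable function preserves the integrability of local suprema. -/
theorem SupIntegrable.conv [SecondCountableTopology X] [SFinite (volume : Measure X)]
    [(volume : Measure X).IsNegInvariant] {F K H : X → ℝ≥0∞} (hF : SupIntegrable F) (hK : AEMeasurable K)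
    (hK' : ∫⁻ w, K w < ∞) (h : ∀ z, H z ≤ ∫⁻ w, K w * F (w - z)) : SupIntegrable H := by
  intro R
  have hS := measurable_localSup R F
  -- Reflection about `w` is an isometry, so the local supremum moves under the integral onto `F`;
  -- Tonelli then separates the two factors.
  have h1 : ∀ z, localSup R H z ≤
      ∫⁻ w, K w * localSup R F (w - z) := by
    intro z
    refine localSup_le fun y hy => (h y).trans (lintegral_mono fun w => ?_)
    gcongr
    refine le_localSup ?_
    rwa [dist_sub_left]
  refine (lintegral_mono h1).trans_lt ?_
  rw [lintegral_lintegral_swap]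
  · have h2 : ∀ w, ∫⁻ z, K w * localSup R F (w - z)
        = K w * ∫⁻ z, localSup R F z := by
      intro w
      rw [lintegral_const_mul _ (by fun_prop), lintegral_sub_left_eq_self]
    simp_rw [h2]
    rw [lintegral_mul_const'' _ hK]
    exact ENNReal.mul_lt_top hK' (hF R)
  · refine AEMeasurable.mul ?_ ?_
    · exact hK.comp_quasiMeasurePreserving Measure.quasiMeasurePreserving_snd
    · exact (hS.comp (measurable_snd.sub measurable_fst)).aemeasurable

/-- Sums over uniformly separated points are bounded by the integral of a local supremum. -/
theorem tsum_le_of_separated {ι : Type*} [Countable ι] {r : ℝ} (p : ι → X)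
    (hp : ∀ i j, i ≠ j → 2 * r ≤ dist (p i) (p j)) (F : X → ℝ≥0∞) :
    (∑' i, F (p i)) * volume (Metric.ball (0 : X) r) ≤ ∫⁻ z, localSup r F z := by
  -- On the ball around `p i` the local supremum dominates the constant `F (p i)`, and the
  -- separation makes these balls disjoint.
  have h1 : ∀ i, F (p i) * volume (Metric.ball (0 : X) r) ≤
      ∫⁻ z in Metric.ball (p i) r, localSup r F z := by
    intro i
    have h2 : volume (Metric.ball (0 : X) r) = volume (Metric.ball (p i) r) := by
      simpa using (measure_preimage_add volume (-p i) (Metric.ball (0 : X) r)).symm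
    rw [h2, ← setLIntegral_const]
    refine setLIntegral_mono (measurable_localSup r F) fun z hz => le_localSup ?_
    rwa [dist_comm]
  rw [← ENNReal.tsum_mul_right]
  refine (ENNReal.tsum_le_tsum h1).trans ?_
  rw [← lintegral_iUnion (fun i => measurableSet_ball)]
  · exact setLIntegral_le_lintegral _ _
  · intro i j hij
    refine Metric.ball_disjoint_ball ?_
    linarith [hp i j hij]

/-- The constant depends only on the separation, not on the family of points; this makes
periodizations bounded uniformly in the base point. -/
theorem SupIntegrable.exists_tsum_le {F : X → ℝ≥0∞} (hF : SupIntegrable F) {r : ℝ} (hr : 0 < r) :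
    ∃ C : ℝ≥0∞, C ≠ ∞ ∧ ∀ {ι : Type} [Countable ι] (p : ι → X),
      (∀ i j, i ≠ j → 2 * r ≤ dist (p i) (p j)) → ∑' i, F (p i) ≤ C := by
  have h0 : volume (Metric.ball (0 : X) r) ≠ 0 := (Metric.measure_ball_pos _ _ hr).ne'
  refine ⟨(∫⁻ z, localSup r F z) / volume (Metric.ball (0 : X) r),
    ENNReal.div_ne_top (hF r).ne h0, fun p hp => ?_⟩
  -- `X` is not assumed proper, so the ball may have infinite volume; finiteness of the integral
  -- then forces the sum to vanish.
  by_cases htop : volume (Metric.ball (0 : X) r) = ∞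
  · have h1 := tsum_le_of_separated p hp F
    rw [htop] at h1
    have h2 : ∑' i, F (p i) = 0 := by
      by_contra h
      rw [ENNReal.mul_top h] at h1
      exact absurd (hF r) (not_lt.2 h1)
    rw [h2]
    exact zero_le
  · exact (ENNReal.le_div_iff_mul_le (Or.inl h0) (Or.inl htop)).2 (tsum_le_of_separated p hp F)

end LocalSup

/-! ### Lattices and sums over lattice points. -/

section Lattice

variable {d : ℕ}

theorem latticePoint_add (c : ℝ) (k l : Fin d → ℤ) :
    latticePoint c (k + l) = latticePoint c k + latticePoint c l := by
  ext i
  simp [latticePoint, mul_add]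

theorem latticePoint_neg (c : ℝ) (k : Fin d → ℤ) : latticePoint c (-k) = -latticePoint c k := by
  ext i
  simp [latticePoint]

theorem latticePoint_sub (c : ℝ) (k l : Fin d → ℤ) :
    latticePoint c (k - l) = latticePoint c k - latticePoint c l := by
  rw [sub_eq_add_neg, latticePoint_add, latticePoint_neg, sub_eq_add_neg]

theorem smul_latticePoint (a c : ℝ) (k : Fin d → ℤ) :
    a • latticePoint c k = latticePoint (a * c) k := by
  ext i
  simp [latticePoint, mul_assoc]

theorem le_dist_latticePoint {c : ℝ} (hc : 0 < c) {k l : Fin d → ℤ} (h : k ≠ l) :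
    c ≤ dist (latticePoint c k) (latticePoint c l) := by
  obtain ⟨i, hi⟩ := Function.ne_iff.1 h
  have h1 : (1 : ℝ) ≤ |((k i - l i : ℤ) : ℝ)| := by
    rw [← Int.cast_abs]
    exact_mod_cast Int.one_le_abs (sub_ne_zero.2 hi)
  have h2 := PiLp.norm_apply_le (latticePoint c k - latticePoint c l) i
  rw [dist_eq_norm]
  refine le_trans ?_ h2
  simp only [latticePoint, PiLp.sub_apply, ← mul_sub, norm_mul, Real.norm_eq_abs, abs_of_pos hc]
  push_cast at h1
  nlinarith

theorem le_dist_latticePoint_prod {a b : ℝ} (ha : 0 < a) (hb : 0 < b)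
    {k l : (Fin d → ℤ) × (Fin d → ℤ)} (h : k ≠ l) :
    min a b ≤ dist (latticePoint a k.1, latticePoint b k.2)
      (latticePoint a l.1, latticePoint b l.2) := by
  rw [Prod.dist_eq]
  by_cases h1 : k.1 = l.1
  · have h2 : k.2 ≠ l.2 := fun h2 => h (Prod.ext h1 h2)
    exact le_max_of_le_right ((min_le_right _ _).trans (le_dist_latticePoint hb h2))
  · exact le_max_of_le_left ((min_le_left _ _).trans (le_dist_latticePoint ha h1))

/-- Periodizations of functions with integrable local suprema are uniformly bounded. -/
theorem SupIntegrable.exists_tsum_lattice_le {F : EuclideanSpace ℝ (Fin d) → ℝ≥0∞}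
    (hF : SupIntegrable F) {c : ℝ} (hc : 0 < c) :
    ∃ C : ℝ≥0∞, C ≠ ∞ ∧ ∀ x, ∑' k : Fin d → ℤ, F (x + latticePoint c k) ≤ C := by
  obtain ⟨C, hC, h⟩ := hF.exists_tsum_le (half_pos hc)
  refine ⟨C, hC, fun x => h (fun k => x + latticePoint c k) fun i j hij => ?_⟩
  rw [dist_add_left]
  linarith [le_dist_latticePoint hc hij]

theorem SupIntegrable.exists_tsum_lattice_sub_le {F : EuclideanSpace ℝ (Fin d) → ℝ≥0∞}
    (hF : SupIntegrable F) {c : ℝ} (hc : 0 < c) :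
    ∃ C : ℝ≥0∞, C ≠ ∞ ∧ ∀ x, ∑' k : Fin d → ℤ, F (x - latticePoint c k) ≤ C := by
  obtain ⟨C, hC, h⟩ := hF.exists_tsum_lattice_le hc
  refine ⟨C, hC, fun x => ?_⟩
  rw [← (Equiv.neg (Fin d → ℤ)).tsum_eq]
  simpa [latticePoint_neg] using h x

instance : (volume : Measure (EuclideanSpace ℝ (Fin d) ×
    EuclideanSpace ℝ (Fin d))).IsAddHaarMeasure :=
  inferInstanceAs ((volume : Measure (EuclideanSpace ℝ (Fin d))).prod
    (volume : Measure (EuclideanSpace ℝ (Fin d)))).IsAddHaarMeasure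

instance : (volume : Measure (EuclideanSpace ℝ (Fin d) ×
    EuclideanSpace ℝ (Fin d))).IsNegInvariant :=
  Measure.IsAddHaarMeasure.isNegInvariant_of_regular volume

/-- Applied to windowed Fourier transforms, this is the source of the absolute summability of
Janssen's coefficients. -/
theorem SupIntegrable.tsum_lattice_prod_lt_top
    {F : EuclideanSpace ℝ (Fin d) × EuclideanSpace ℝ (Fin d) → ℝ≥0∞}
    (hF : SupIntegrable F) {a b : ℝ} (ha : 0 < a) (hb : 0 < b) :
    ∑' k : (Fin d → ℤ) × (Fin d → ℤ), F (latticePoint a k.1, latticePoint b k.2) < ∞ := by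
  obtain ⟨C, hC, h⟩ := hF.exists_tsum_le (half_pos (lt_min ha hb))
  refine (h (fun k : (Fin d → ℤ) × (Fin d → ℤ) => (latticePoint a k.1, latticePoint b k.2))
    fun i j hij => ?_).trans_lt hC.lt_top
  linarith [le_dist_latticePoint_prod ha hb hij]

end Lattice

/-! ### The Fourier transform of integrable functions -/

section Fourier

variable {V : Type*} [NormedAddCommGroup V] [InnerProductSpace ℝ V] [FiniteDimensional ℝ V]
  [MeasurableSpace V] [BorelSpace V]

theorem continuous_fourier {f : V → ℂ} (hf : Integrable f) : Continuous (𝓕 f) :=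
  VectorFourier.fourierIntegral_continuous Real.continuous_fourierChar continuous_inner hf

theorem continuous_fourierInv {f : V → ℂ} (hf : Integrable f) : Continuous (𝓕⁻ f) := by
  have : 𝓕⁻ f = fun w => 𝓕 f (-w) := funext fun w => Real.fourierInv_eq_fourier_neg f w
  rw [this]
  exact (continuous_fourier hf).comp continuous_neg

theorem norm_fourier_le {f : V → ℂ} (w : V) : ‖𝓕 f w‖ ≤ ∫ x, ‖f x‖ :=
  VectorFourier.norm_fourierIntegral_le_integral_norm _ _ _ _ _

theorem integral_fourier_mul {f g : V → ℂ} (hf : Integrable f) (hg : Integrable g) :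
    ∫ x, 𝓕 f x * g x = ∫ x, f x * 𝓕 g x := by
  have := VectorFourier.integral_fourierIntegral_smul_eq_flip (μ := (volume : Measure V))
    (ν := (volume : Measure V)) (L := innerₗ V) Real.continuous_fourierChar continuous_inner hf hg
  rw [flip_innerₗ] at this
  exact this

theorem integral_fourierInv_mul {f g : V → ℂ} (hf : Integrable f) (hg : Integrable g) :
    ∫ x, 𝓕⁻ f x * g x = ∫ x, f x * 𝓕⁻ g x := by
  have h1 : ∀ x, 𝓕⁻ f x = 𝓕 (fun y => f (-y)) x := fun x => by
    rw [Real.fourierInv_eq_fourier_comp_neg]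
  have h2 : ∀ x, 𝓕⁻ g x = 𝓕 g (-x) := fun x => Real.fourierInv_eq_fourier_neg g x
  simp_rw [h1, h2]
  rw [integral_fourier_mul hf.comp_neg hg, ← integral_neg_eq_self]
  simp

/-- Fourier inversion for integrable functions with integrable Fourier transform. -/
theorem ae_eq_fourierInv_fourier {v : V → ℂ} (hv : Integrable v) (hv' : Integrable (𝓕 v)) :
    v =ᵐ[volume] 𝓕⁻ (𝓕 v) := by
  refine ae_eq_of_integral_contDiff_smul_eq hv.locallyIntegrable
    (continuous_fourierInv hv').locallyIntegrable fun φ hφ hφ' => ?_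
  have hφ₁ : HasCompactSupport (Complex.ofRealCLM ∘ φ) := hφ'.comp_left rfl
  have hφ₂ : ContDiff ℝ ((⊤ : ℕ∞) : WithTop ℕ∞) (Complex.ofRealCLM ∘ φ) := by fun_prop
  -- The test function is Schwartz, where inversion is known, so it is the Fourier transform of `θ`.
  -- Two uses of the multiplication formula then carry inversion over to `v`.
  let ψ : SchwartzMap V ℂ := hφ₁.toSchwartzMap hφ₂
  let θ : SchwartzMap V ℂ := 𝓕⁻ ψ
  have hθ : ∀ x, 𝓕 (θ : V → ℂ) x = φ x := by
    intro x
    have h1 : 𝓕 θ = ψ := FourierTransform.fourier_fourierInv_eq ψ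
    rw [← SchwartzMap.fourier_coe, h1]
    rfl
  have hθ' : ∀ x, θ x = 𝓕⁻ (fun y => (φ y : ℂ)) x := by
    intro x
    change (𝓕⁻ ψ : SchwartzMap V ℂ) x = _
    rw [SchwartzMap.fourierInv_coe]
    rfl
  have hφi : Integrable fun y => (φ y : ℂ) := ψ.integrable
  calc ∫ x, φ x • v x = ∫ x, v x * 𝓕 (θ : V → ℂ) x := by
        congr 1; funext x; rw [hθ, Complex.real_smul, mul_comm]
    _ = ∫ x, 𝓕 v x * θ x := (integral_fourier_mul hv θ.integrable).symm
    _ = ∫ x, 𝓕 v x * 𝓕⁻ (fun y => (φ y : ℂ)) x := by simp_rw [hθ']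
    _ = ∫ x, 𝓕⁻ (𝓕 v) x * φ x := (integral_fourierInv_mul hv' hφi).symm
    _ = ∫ x, φ x • 𝓕⁻ (𝓕 v) x := by
        congr 1; funext x; rw [Complex.real_smul, mul_comm]

theorem ae_eq_zero_of_fourier_eq_zero {v : V → ℂ} (hv : Integrable v) (h : ∀ w, 𝓕 v w = 0) :
    v =ᵐ[volume] 0 := by
  have h0 : 𝓕 v = fun _ => 0 := funext h
  refine (ae_eq_fourierInv_fourier hv (by rw [h0]; exact integrable_zero _ _ _)).trans ?_
  refine Filter.Eventually.of_forall fun x => ?_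
  rw [h0, Real.fourierInv_eq]
  simp

theorem conj_fourierInv (f : V → ℂ) (x : V) : conj (𝓕⁻ f x) = 𝓕 (fun y => conj (f y)) x := by
  rw [Real.fourierInv_eq, Real.fourier_eq, ← integral_conj]
  congr 1
  funext y
  simp [Circle.smul_def, ← Circle.coe_inv_eq_conj, AddChar.map_neg_eq_inv]

/-- Parseval's identity. -/
theorem integral_fourier_mul_conj_fourier {u v : V → ℂ} (hu : Integrable u) (hv : Integrable v)
    (hv' : Integrable (𝓕 v)) :
    ∫ w, 𝓕 u w * conj (𝓕 v w) = ∫ x, u x * conj (v x) := by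
  have hc : Integrable fun w => conj (𝓕 v w) :=
    Complex.conjCLE.toContinuousLinearMap.integrable_comp hv'
  rw [integral_fourier_mul hu hc]
  refine integral_congr_ae ?_
  filter_upwards [ae_eq_fourierInv_fourier hv hv'] with x hx
  rw [hx, conj_fourierInv]

theorem ae_enorm_le_lintegral_fourier {v : V → ℂ} (hv : Integrable v) (hv' : Integrable (𝓕 v)) :
    ∀ᵐ x, ‖v x‖ₑ ≤ ∫⁻ w, ‖𝓕 v w‖ₑ := by
  filter_upwards [ae_eq_fourierInv_fourier hv hv'] with x hx
  rw [hx, Real.fourierInv_eq]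
  refine (enorm_integral_le_lintegral_enorm _).trans (le_of_eq ?_)
  congr 1
  funext w
  rw [← ofReal_norm, ← ofReal_norm, Circle.norm_smul]

end Fourier

/-! ### Fourier uniqueness on the torus -/

section Torus

local instance : MeasureSpace UnitAddCircle := ⟨AddCircle.haarAddCircle⟩

variable {ι : Type*} [Fintype ι]

theorem integral_mFourier [DecidableEq ι] (n : ι → ℤ) :
    ∫ t : UnitAddTorus ι, UnitAddTorus.mFourier n t = if n = 0 then 1 else 0 := by
  have h := orthonormal_iff_ite.1 (UnitAddTorus.orthonormal_mFourier (d := ι)) 0 n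
  rw [ContinuousMap.inner_toLp] at h
  simpa [UnitAddTorus.mFourier_zero, eq_comm] using h

/-- An integrable function on the torus is determined by its Fourier coefficients. -/
theorem ae_eq_zero_of_mFourierCoeff_eq_zero {f : UnitAddTorus ι → ℂ} (hf : Integrable f)
    (h : ∀ n, UnitAddTorus.mFourierCoeff f n = 0) : f =ᵐ[volume] 0 := by
  -- Integration against `f` is a continuous functional on `C(𝕋^d)`. It vanishes on the characters,
  -- whose span is dense, hence everywhere. Only `f ∈ L^1` is available, so the `L²` theory of
  -- Fourier series does not suffice.
  let T : C(UnitAddTorus ι, ℂ) →ₗ[ℂ] ℂ :=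
    { toFun := fun φ => ∫ t, φ t * f t
      map_add' := by
        intro φ ψ
        simp only [ContinuousMap.add_apply, add_mul]
        exact integral_add (hf.bdd_mul φ.continuous.aestronglyMeasurable
          (Filter.Eventually.of_forall φ.norm_coe_le_norm)) (hf.bdd_mul
          ψ.continuous.aestronglyMeasurable (Filter.Eventually.of_forall ψ.norm_coe_le_norm))
      map_smul' := by
        intro c φ
        simp only [ContinuousMap.smul_apply, smul_eq_mul, mul_assoc, RingHom.id_apply]
        exact integral_const_mul _ _ }
  have hT : ∀ φ, ‖T φ‖ ≤ (∫ t, ‖f t‖) * ‖φ‖ := by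
    intro φ
    refine (norm_integral_le_integral_norm _).trans ?_
    rw [mul_comm, ← integral_const_mul]
    refine integral_mono_of_nonneg (Filter.Eventually.of_forall fun t => norm_nonneg _)
      (hf.norm.const_mul _) (Filter.Eventually.of_forall fun t => ?_)
    simp only [norm_mul]
    gcongr
    exact φ.norm_coe_le_norm t
  let T' : C(UnitAddTorus ι, ℂ) →L[ℂ] ℂ := T.mkContinuous _ hT
  have hT0 : T' = 0 := by
    refine ContinuousLinearMap.ext_on (s := Set.range (UnitAddTorus.mFourier (d := ι))) ?_ ?_
    · rw [Submodule.dense_iff_topologicalClosure_eq_top]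
      exact UnitAddTorus.span_mFourier_closure_eq_top
    · rintro _ ⟨n, rfl⟩
      have := h (-n)
      change ∫ t, UnitAddTorus.mFourier n t * f t = 0
      simpa [UnitAddTorus.mFourierCoeff] using this
  refine ae_eq_zero_of_forall_setIntegral_isClosed_eq_zero hf fun s hs => ?_
  -- Indicators of closed sets are pointwise limits of continuous thickened indicators, so the
  -- integral of `f` over every closed set vanishes.
  have h1 : ∀ n : ℕ, ∫ t, ((thickenedIndicator (Nat.one_div_pos_of_nat (n := n) (α := ℝ)) s t : ℝ)
      : ℂ) * f t = 0 := by
    intro n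
    have := congrArg (fun S : C(UnitAddTorus ι, ℂ) →L[ℂ] ℂ => S
      ⟨fun t => ((thickenedIndicator (Nat.one_div_pos_of_nat (n := n) (α := ℝ)) s t : ℝ) : ℂ),
        by fun_prop⟩) hT0
    exact this
  have h2 : Filter.Tendsto (fun n : ℕ => ∫ t, ((thickenedIndicator
      (Nat.one_div_pos_of_nat (n := n) (α := ℝ)) s t : ℝ) : ℂ) * f t) Filter.atTop
      (nhds (∫ t, s.indicator f t)) := by
    refine tendsto_integral_of_dominated_convergence (fun t => ‖f t‖) (fun n => ?_) hf.norm
      (fun n => Filter.Eventually.of_forall fun t => ?_) (Filter.Eventually.of_forall fun t => ?_)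
    · refine AEStronglyMeasurable.mul (Continuous.aestronglyMeasurable ?_) hf.1
      fun_prop
    · rw [norm_mul, Complex.norm_real, Real.norm_eq_abs, NNReal.abs_eq]
      refine mul_le_of_le_one_left (norm_nonneg _) ?_
      exact_mod_cast thickenedIndicator_le_one _ s t
    · have h3 := thickenedIndicator_tendsto_indicator_closure
        (fun n : ℕ => Nat.one_div_pos_of_nat (n := n) (α := ℝ))
        tendsto_one_div_add_atTop_nhds_zero_nat s
      rw [tendsto_pi_nhds] at h3
      have h4 := h3 t
      rw [hs.closure_eq] at h4
      have h5 := (Complex.continuous_ofReal.comp NNReal.continuous_coe).continuousAt.tendsto.comp h4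
      have h6 := h5.mul_const (f t)
      refine (h6.congr fun n => rfl).trans_eq ?_
      by_cases ht : t ∈ s <;> simp [ht]
  simp_rw [h1] at h2
  rw [← integral_indicator hs.measurableSet]
  exact (tendsto_nhds_unique tendsto_const_nhds h2).symm

variable {d : ℕ}

/-- The projection of `ℝ^d` onto the torus. -/
def torusMk (x : EuclideanSpace ℝ (Fin d)) : UnitAddTorus (Fin d) := fun i => (x i : UnitAddCircle)

theorem mFourier_torusMk (n : Fin d → ℤ) (x : EuclideanSpace ℝ (Fin d)) :
    UnitAddTorus.mFourier n (torusMk x) = character (latticePoint 1 n) x := by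
  simp only [UnitAddTorus.mFourier, ContinuousMap.coe_mk, torusMk, fourier_coe_apply, character,
    ← Complex.exp_sum]
  congr 1
  simp only [latticePoint, PiLp.inner_apply, one_mul, RCLike.inner_apply, conj_trivial]
  push_cast
  rw [Finset.mul_sum]
  refine Finset.sum_congr rfl fun i _ => ?_
  ring

/-- The half-open unit box `(0,1]^d`. -/
def unitBox (d : ℕ) : Set (EuclideanSpace ℝ (Fin d)) := {x | ∀ i, x i ∈ Set.Ioc (0 : ℝ) (0 + 1)}

theorem measurableSet_unitBox : MeasurableSet (unitBox d) := by
  have : unitBox d = ⋂ i, (fun x : EuclideanSpace ℝ (Fin d) => x i) ⁻¹' Set.Ioc (0 : ℝ) (0 + 1) := by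
    ext x; simp [unitBox]
  rw [this]
  exact MeasurableSet.iInter fun i => measurableSet_Ioc.preimage (by fun_prop)

theorem existsUnique_sub_mem_unitBox (x : EuclideanSpace ℝ (Fin d)) :
    ∃! k : Fin d → ℤ, x - latticePoint 1 k ∈ unitBox d := by
  -- The box is open on the left and closed on the right, which forces `⌈x i⌉ - 1` instead of the
  -- floor.
  refine ⟨fun i => ⌈x i⌉ - 1, fun i => ?_, fun k hk => funext fun i => ?_⟩
  · have h1 := Int.ceil_lt_add_one (x i)
    have h2 := Int.le_ceil (x i)
    simp only [latticePoint, PiLp.sub_apply, Set.mem_Ioc]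
    push_cast
    constructor <;> linarith
  · have := hk i
    simp only [latticePoint, PiLp.sub_apply, Set.mem_Ioc] at this
    have h3 : ⌈x i⌉ = k i + 1 := by
      rw [Int.ceil_eq_iff]
      push_cast
      constructor <;> linarith
    rw [h3]
    ring

/-- The section of the projection onto the torus with values in the unit box. -/
def torusLift (t : UnitAddTorus (Fin d)) : EuclideanSpace ℝ (Fin d) :=
  WithLp.toLp 2 (UnitAddTorus.measurableEquivPiIoc (fun _ : Fin d => (0 : ℝ)) t).1

theorem torusMk_torusLift (t : UnitAddTorus (Fin d)) : torusMk (torusLift t) = t :=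
  (UnitAddTorus.measurableEquivPiIoc (fun _ : Fin d => (0 : ℝ))).symm_apply_apply t

theorem torusLift_torusMk {x : EuclideanSpace ℝ (Fin d)} (hx : x ∈ unitBox d) :
    torusLift (torusMk x) = x := by
  have := (UnitAddTorus.measurableEquivPiIoc (fun _ : Fin d => (0 : ℝ))).apply_symm_apply
    ⟨fun i => x i, hx⟩
  have h2 : UnitAddTorus.measurableEquivPiIoc (fun _ : Fin d => (0 : ℝ)) (torusMk x)
      = ⟨fun i => x i, hx⟩ := this
  rw [torusLift, h2]

theorem measurePreserving_torusLift :
    MeasurePreserving (torusLift (d := d)) volume (volume.restrict (unitBox d)) := by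
  have h1 := UnitAddTorus.measurePreserving_equivPiIoc (fun _ : Fin d => (0 : ℝ))
  have hm : MeasurableSet {x : Fin d → ℝ | ∀ i, x i ∈ Set.Ioc (0 : ℝ) (0 + 1)} :=
    MeasurableSet.univ_pi' fun i => measurableSet_Ioc
  have h2 : MeasurePreserving (Subtype.val : {x : Fin d → ℝ // ∀ i, x i ∈ Set.Ioc (0 : ℝ) (0 + 1)} → _)
      (Measure.comap Subtype.val volume)
      (volume.restrict {x : Fin d → ℝ | ∀ i, x i ∈ Set.Ioc (0 : ℝ) (0 + 1)}) :=
    measurePreserving_subtype_coe hm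
  have h3 := (PiLp.volume_preserving_toLp (Fin d)).restrict_preimage (measurableSet_unitBox (d := d))
  exact h3.comp (h2.comp h1)

theorem measurePreserving_torusMk :
    MeasurePreserving (torusMk (d := d)) (volume.restrict (unitBox d)) volume := by
  have hm : Measurable (torusMk (d := d)) :=
    measurable_pi_lambda _ fun i => AddCircle.measurable_mk'.comp (by fun_prop)
  refine ⟨hm, ?_⟩
  rw [← measurePreserving_torusLift.map_eq, Measure.map_map hm measurePreserving_torusLift.1]
  have : torusMk (d := d) ∘ torusLift = id := funext torusMk_torusLift
  rw [this, Measure.map_id]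

end Torus

/-! ### The Poisson summation formula -/

section Poisson

variable {d : ℕ}

theorem norm_character (ω x : EuclideanSpace ℝ (Fin d)) : ‖character ω x‖ = 1 := by
  rw [character, show 2 * (Real.pi : ℂ) * Complex.I * ((⟪ω, x⟫ : ℝ) : ℂ)
    = ((2 * Real.pi * ⟪ω, x⟫ : ℝ) : ℂ) * Complex.I by push_cast; ring]
  exact Complex.norm_exp_ofReal_mul_I _

theorem enorm_character (ω x : EuclideanSpace ℝ (Fin d)) : ‖character ω x‖ₑ = 1 := by
  rw [← ofReal_norm, norm_character, ENNReal.ofReal_one]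

theorem conj_character (ω x : EuclideanSpace ℝ (Fin d)) :
    conj (character ω x) = character (-ω) x := by
  rw [character, character, ← Complex.exp_conj]
  congr 1
  simp only [map_mul, Complex.conj_ofReal, Complex.conj_I, inner_neg_left, map_ofNat]
  push_cast
  ring

theorem character_add_left (ω η x : EuclideanSpace ℝ (Fin d)) :
    character (ω + η) x = character ω x * character η x := by
  rw [character, character, character, ← Complex.exp_add, inner_add_left]
  push_cast
  ring_nf

theorem character_add (ω x y : EuclideanSpace ℝ (Fin d)) :
    character ω (x + y) = character ω x * character ω y := by
  rw [character, character, character, ← Complex.exp_add, inner_add_right]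
  push_cast
  ring_nf

theorem character_smul (c : ℝ) (ω x : EuclideanSpace ℝ (Fin d)) :
    character (c • ω) x = character ω (c • x) := by
  rw [character, character, inner_smul_left, inner_smul_right]
  rfl

theorem character_zero (x : EuclideanSpace ℝ (Fin d)) : character 0 x = 1 := by
  simp [character]

theorem character_one_latticePoint (m k : Fin d → ℤ) :
    character (latticePoint 1 m) (latticePoint 1 k) = 1 := by
  rw [character, Complex.exp_eq_one_iff]
  refine ⟨∑ i, m i * k i, ?_⟩
  simp only [latticePoint, PiLp.inner_apply, one_mul, RCLike.inner_apply, conj_trivial]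
  push_cast
  simp_rw [mul_comm (k _ : ℂ)]
  ring

theorem fourier_eq_integral_character (v : EuclideanSpace ℝ (Fin d) → ℂ)
    (w : EuclideanSpace ℝ (Fin d)) : 𝓕 v w = ∫ x, v x * conj (character w x) := by
  rw [Real.fourier_eq']
  congr 1
  funext x
  rw [conj_character, character, smul_eq_mul, mul_comm, inner_neg_left, real_inner_comm]
  congr 2
  push_cast
  ring

theorem _root_.MeasureTheory.Integrable.mul_conj_character {v : EuclideanSpace ℝ (Fin d) → ℂ}
    (hv : Integrable v) (w : EuclideanSpace ℝ (Fin d)) :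
    Integrable fun x => v x * conj (character w x) := by
  refine hv.mul_bdd (c := 1) (Complex.continuous_conj.comp
    (continuous_character _)).aestronglyMeasurable (Filter.Eventually.of_forall fun x => ?_)
  exact (RCLike.norm_conj _).trans_le (norm_character _ _).le

theorem tsum_lintegral_unitBox {F : EuclideanSpace ℝ (Fin d) → ℝ≥0∞} :
    ∑' k : Fin d → ℤ, ∫⁻ x in unitBox d, F (x + latticePoint 1 k) = ∫⁻ x, F x := by
  have hB : ∀ k : Fin d → ℤ, MeasurableSet ((fun x => x - latticePoint 1 k) ⁻¹' unitBox d) :=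
    fun k => measurableSet_unitBox.preimage (measurable_sub_const _)
  have h1 : ∀ k : Fin d → ℤ, ∫⁻ x in unitBox d, F (x + latticePoint 1 k)
      = ∫⁻ x in (fun x => x - latticePoint 1 k) ⁻¹' unitBox d, F x := by
    intro k
    have := (measurePreserving_sub_right volume (latticePoint 1 k)).setLIntegral_comp_preimage_emb
      (MeasurableEquiv.subRight _).measurableEmbedding
      (fun x => F (x + latticePoint 1 k)) (unitBox d)
    simpa using this.symm
  simp_rw [h1]
  rw [← lintegral_iUnion hB]
  · rw [← setLIntegral_univ]
    congr 1
    have hU : (⋃ k : Fin d → ℤ, (fun x => x - latticePoint 1 k) ⁻¹' unitBox d) = Set.univ :=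
      Set.eq_univ_of_forall fun x => Set.mem_iUnion.2 (existsUnique_sub_mem_unitBox x).exists
    rw [hU, Measure.restrict_univ, Measure.restrict_univ]
  · intro k l hkl
    refine Set.disjoint_left.2 fun x hk hl => hkl ?_
    exact (existsUnique_sub_mem_unitBox x).unique hk hl

theorem hasSum_integral_unitBox {F : EuclideanSpace ℝ (Fin d) → ℂ} (hF : Integrable F) :
    HasSum (fun k : Fin d → ℤ => ∫ x in unitBox d, F (x + latticePoint 1 k)) (∫ x, F x) := by
  have hB : ∀ k : Fin d → ℤ, MeasurableSet ((fun x => x - latticePoint 1 k) ⁻¹' unitBox d) :=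
    fun k => measurableSet_unitBox.preimage (measurable_sub_const _)
  have h1 : ∀ k : Fin d → ℤ, ∫ x in unitBox d, F (x + latticePoint 1 k)
      = ∫ x in (fun x => x - latticePoint 1 k) ⁻¹' unitBox d, F x := by
    intro k
    have := (measurePreserving_sub_right volume (latticePoint 1 k)).setIntegral_preimage_emb
      (MeasurableEquiv.subRight _).measurableEmbedding
      (fun x => F (x + latticePoint 1 k)) (unitBox d)
    simpa using this.symm
  simp_rw [h1]
  have hU : (⋃ k : Fin d → ℤ, (fun x => x - latticePoint 1 k) ⁻¹' unitBox d) = Set.univ :=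
    Set.eq_univ_of_forall fun x => Set.mem_iUnion.2 (existsUnique_sub_mem_unitBox x).exists
  have := hasSum_integral_iUnion (μ := volume) (f := F) hB (fun k l hkl =>
    Set.disjoint_left.2 fun x hk hl => hkl ((existsUnique_sub_mem_unitBox x).unique hk hl))
    hF.integrableOn
  rwa [hU, setIntegral_univ] at this

/-- The integer translates of the box cover the space, and the countably many translated exceptional
sets are null. -/
theorem ae_of_ae_unitBox {p : EuclideanSpace ℝ (Fin d) → Prop}
    (hp : ∀ᵐ x ∂volume.restrict (unitBox d), p x)
    (h : ∀ (x : EuclideanSpace ℝ (Fin d)) (k : Fin d → ℤ), p x → p (x + latticePoint 1 k)) :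
    ∀ᵐ x, p x := by
  rw [ae_restrict_iff' measurableSet_unitBox] at hp
  have h1 : ∀ᵐ x, ∀ k : Fin d → ℤ, x - latticePoint 1 k ∈ unitBox d → p (x - latticePoint 1 k) :=
    ae_all_iff.2 fun k =>
      (measurePreserving_sub_right volume (latticePoint 1 k)).quasiMeasurePreserving.ae hp
  filter_upwards [h1] with x hx
  obtain ⟨k, hk⟩ := (existsUnique_sub_mem_unitBox x).exists
  simpa using h _ k (hx k hk)

/-- Unfolding: the character is `ℤ^d`-periodic, so integrating a periodization against it over the
box is integrating `v` against it over the whole space. -/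
theorem hasSum_character_unitBox {v : EuclideanSpace ℝ (Fin d) → ℂ} (hv : Integrable v)
    (m : Fin d → ℤ) :
    Integrable (fun x => ∑' k : Fin d → ℤ, v (x + latticePoint 1 k)) (volume.restrict (unitBox d)) ∧
    ∫ x in unitBox d, (∑' k : Fin d → ℤ, v (x + latticePoint 1 k)) *
      conj (character (latticePoint 1 m) x) = 𝓕 v (latticePoint 1 m) := by
  have hvm : ∀ k : Fin d → ℤ, AEStronglyMeasurable (fun x => v (x + latticePoint 1 k))
      (volume.restrict (unitBox d)) := fun k => (hv.1.comp_measurePreserving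
        (measurePreserving_add_right volume (latticePoint 1 k))).restrict
  have hsum : ∑' k : Fin d → ℤ, ∫⁻ x in unitBox d, ‖v (x + latticePoint 1 k)‖ₑ ≠ ∞ := by
    rw [tsum_lintegral_unitBox (F := fun x => ‖v x‖ₑ)]
    exact hv.2.ne
  constructor
  · refine ⟨(AEMeasurable.tsum fun k => (hvm k).aemeasurable).aestronglyMeasurable, ?_⟩
    refine (lintegral_mono fun x => enorm_tsum_le_tsum_enorm).trans_lt ?_
    rw [lintegral_tsum fun k => (hvm k).enorm]
    exact hsum.lt_top
  · have hc : AEStronglyMeasurable (fun x => conj (character (latticePoint 1 m) x))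
        (volume.restrict (unitBox d)) :=
      (Complex.continuous_conj.comp (continuous_character _)).aestronglyMeasurable
    simp_rw [← tsum_mul_right]
    rw [integral_tsum (fun k => by exact (hvm k).mul hc), fourier_eq_integral_character]
    · rw [← (hasSum_integral_unitBox (hv.mul_conj_character _)).tsum_eq]
      simp_rw [character_add, character_one_latticePoint, mul_one]
    · refine ne_of_lt (lt_of_eq_of_lt ?_ hsum.lt_top)
      simp_rw [enorm_mul, RCLike.enorm_conj, enorm_character, mul_one]

theorem hasSum_mFourier_of_summable {c : (Fin d → ℤ) → ℂ} (hc : Summable fun m => ‖c m‖) :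
    Summable fun m => c m • UnitAddTorus.mFourier m :=
  Summable.of_norm (by simpa [norm_smul, UnitAddTorus.mFourier_norm] using hc)

local instance : MeasureSpace UnitAddCircle := ⟨AddCircle.haarAddCircle⟩

local instance : IsProbabilityMeasure (volume : Measure UnitAddCircle) :=
  inferInstanceAs (IsProbabilityMeasure AddCircle.haarAddCircle)

/-- Absolute summability allows termwise integration, and orthogonality of the characters leaves one
term. -/
theorem mFourierCoeff_tsum {c : (Fin d → ℤ) → ℂ} (hc : Summable fun m => ‖c m‖) (n : Fin d → ℤ) :
    UnitAddTorus.mFourierCoeff (⇑(∑' m, c m • UnitAddTorus.mFourier m :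
      C(UnitAddTorus (Fin d), ℂ))) n = c n := by
  have hs := hasSum_mFourier_of_summable hc
  have h1 : ∀ t, UnitAddTorus.mFourier (-n) t • (∑' m, c m • UnitAddTorus.mFourier m :
      C(UnitAddTorus (Fin d), ℂ)) t = ∑' m, c m * UnitAddTorus.mFourier (m - n) t := by
    intro t
    rw [← ContinuousMap.tsum_apply hs, smul_eq_mul, ← tsum_mul_left]
    refine tsum_congr fun m => ?_
    rw [sub_eq_add_neg, UnitAddTorus.mFourier_add]
    simp only [ContinuousMap.smul_apply, smul_eq_mul]
    ring
  have hn : ∀ (m : Fin d → ℤ) (t : UnitAddTorus (Fin d)), ‖UnitAddTorus.mFourier m t‖ = 1 := by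
    intro m t
    simp only [UnitAddTorus.mFourier, fourier_apply, ContinuousMap.coe_mk, norm_prod,
      Circle.norm_coe, Finset.prod_const_one]
  rw [UnitAddTorus.mFourierCoeff]
  simp_rw [h1]
  rw [integral_tsum]
  · simp_rw [integral_const_mul, integral_mFourier, sub_eq_zero]
    simp
  · intro m
    exact ((UnitAddTorus.mFourier (m - n)).continuous.const_mul (c m)).aestronglyMeasurable
  · simp_rw [enorm_mul]
    have h2 : ∀ (m : Fin d → ℤ) (t : UnitAddTorus (Fin d)), ‖UnitAddTorus.mFourier m t‖ₑ = 1 := by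
      intro m t
      rw [← ofReal_norm, hn, ENNReal.ofReal_one]
    simp only [h2, mul_one, lintegral_const, measure_univ]
    exact tsum_enorm_ne_top_iff_summable_norm.2 hc

/-- The periodization and the continuous function with summable coefficients `𝓕 v(m)` have the same
Fourier coefficients, so they agree a.e. on the torus. Nothing better than a.e. is possible, since
`v` is only an integrable function. -/
theorem ae_tsum_translate_eq_one {v : EuclideanSpace ℝ (Fin d) → ℂ} (hv : Integrable v)
    (hs : Summable fun m : Fin d → ℤ => ‖𝓕 v (latticePoint 1 m)‖) :
    ∀ᵐ x, ∑' k : Fin d → ℤ, v (x + latticePoint 1 k) =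
      ∑' m : Fin d → ℤ, 𝓕 v (latticePoint 1 m) * character (latticePoint 1 m) x := by
  let P : EuclideanSpace ℝ (Fin d) → ℂ := fun x => ∑' k : Fin d → ℤ, v (x + latticePoint 1 k)
  let Q : C(UnitAddTorus (Fin d), ℂ) := ∑' m, 𝓕 v (latticePoint 1 m) • UnitAddTorus.mFourier m
  have hQ : ∀ x, Q (torusMk x) =
      ∑' m : Fin d → ℤ, 𝓕 v (latticePoint 1 m) * character (latticePoint 1 m) x := by
    intro x
    simp only [Q]
    rw [← ContinuousMap.tsum_apply (hasSum_mFourier_of_summable hs)]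
    simp [mFourier_torusMk]
  have hP : Integrable (fun t => P (torusLift t)) :=
    measurePreserving_torusLift.integrable_comp_of_integrable (hasSum_character_unitBox hv 0).1
  have hQi : Integrable (fun t => Q t) :=
    (integrable_const (‖Q‖ : ℝ)).mono' Q.continuous.aestronglyMeasurable
      (Filter.Eventually.of_forall Q.norm_coe_le_norm)
  have hcoef : ∀ n, UnitAddTorus.mFourierCoeff (fun t => P (torusLift t)) n
      = 𝓕 v (latticePoint 1 n) := by
    intro n
    rw [← (hasSum_character_unitBox hv n).2, ← measurePreserving_torusLift.map_eq, integral_map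
      measurePreserving_torusLift.1.aemeasurable]
    · rw [UnitAddTorus.mFourierCoeff]
      congr 1
      funext t
      rw [UnitAddTorus.mFourier_neg, smul_eq_mul, mul_comm, ← mFourier_torusMk, torusMk_torusLift]
    · rw [measurePreserving_torusLift.map_eq]
      exact (hasSum_character_unitBox hv 0).1.1.mul (Complex.continuous_conj.comp
          (continuous_character _)).aestronglyMeasurable
  have hzero := ae_eq_zero_of_mFourierCoeff_eq_zero (hP.sub hQi) fun n => by
    have h1 := hcoef n
    have h2 := mFourierCoeff_tsum hs n
    rw [UnitAddTorus.mFourierCoeff] at h1 h2 ⊢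
    simp only [Pi.sub_apply, smul_sub]
    have hb : ∀ {f : UnitAddTorus (Fin d) → ℂ}, Integrable f →
        Integrable fun t => UnitAddTorus.mFourier (-n) t • f t := fun hf =>
      hf.bdd_mul (UnitAddTorus.mFourier (-n)).continuous.aestronglyMeasurable
        (Filter.Eventually.of_forall (UnitAddTorus.mFourier (-n)).norm_coe_le_norm)
    rw [integral_sub (hb hP) (hb hQi), h1]
    exact sub_eq_zero.2 h2.symm
  have hbox : ∀ᵐ x ∂volume.restrict (unitBox d), P x = Q (torusMk x) := by
    have h1 := measurePreserving_torusMk.quasiMeasurePreserving.ae hzero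
    filter_upwards [h1, ae_restrict_mem measurableSet_unitBox] with x hx hx'
    simp only [Pi.sub_apply, Pi.zero_apply, torusLift_torusMk hx'] at hx
    exact sub_eq_zero.1 hx
  refine ae_of_ae_unitBox (p := fun x => P x = ∑' m : Fin d → ℤ, 𝓕 v (latticePoint 1 m) *
    character (latticePoint 1 m) x) (hbox.mono fun x hx => hx.trans (hQ x)) fun x k hx => ?_
  simp_rw [character_add, character_one_latticePoint, mul_one]
  rw [← hx]
  simpa [P, latticePoint_add, add_assoc] using
    (Equiv.addLeft k).tsum_eq (fun j : Fin d → ℤ => v (x + latticePoint 1 j))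

theorem ae_of_ae_smul {p : EuclideanSpace ℝ (Fin d) → Prop} {c : ℝ} (hc : c ≠ 0)
    (h : ∀ᵐ x, p (c • x)) : ∀ᵐ x, p x := by
  have hq : Measure.QuasiMeasurePreserving (fun x : EuclideanSpace ℝ (Fin d) => c⁻¹ • x) := by
    refine ⟨measurable_const_smul _, ?_⟩
    rw [Measure.map_addHaar_smul _ (inv_ne_zero hc)]
    exact Measure.smul_absolutelyContinuous
  filter_upwards [hq.ae h] with x hx
  rwa [smul_inv_smul₀ hc] at hx

theorem fourier_comp_smul_latticePoint (v : EuclideanSpace ℝ (Fin d) → ℂ) {c : ℝ} (hc : 0 < c)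
    (m : Fin d → ℤ) : 𝓕 (fun x => v (c • x)) (latticePoint 1 m)
      = ((c ^ d : ℝ) : ℂ)⁻¹ * 𝓕 v (latticePoint (1 / c) m) := by
  rw [fourier_eq_integral_character, fourier_eq_integral_character]
  have h1 : ∀ x, v (c • x) * conj (character (latticePoint 1 m) x)
      = (fun y => v y * conj (character (latticePoint (1 / c) m) y)) (c • x) := by
    intro x
    simp only
    rw [← character_smul, smul_latticePoint, mul_one_div_cancel hc.ne']
  rw [integral_congr_ae (Filter.Eventually.of_forall h1), Measure.integral_comp_smul volume
    (fun y => v y * conj (character (latticePoint (1 / c) m) y)) c, finrank_euclideanSpace_fin, abs_of_pos (by positivity),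
    Complex.real_smul]
  push_cast
  rfl

/-- The Poisson summation formula, for an integrable function whose Fourier transform is summable
over the dual lattice. -/
theorem ae_tsum_translate_eq {v : EuclideanSpace ℝ (Fin d) → ℂ} (hv : Integrable v) {c : ℝ}
    (hc : 0 < c) (hs : Summable fun m : Fin d → ℤ => ‖𝓕 v (latticePoint (1 / c) m)‖) :
    ∀ᵐ x, ∑' k : Fin d → ℤ, v (x + latticePoint c k) = ((c ^ d : ℝ) : ℂ)⁻¹ *
      ∑' m : Fin d → ℤ, 𝓕 v (latticePoint (1 / c) m) * character (latticePoint (1 / c) m) x := by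
  have h1 := ae_tsum_translate_eq_one (hv.comp_smul hc.ne') (by
    simp_rw [fourier_comp_smul_latticePoint v hc, norm_mul]
    exact hs.mul_left _)
  refine ae_of_ae_smul hc.ne' ?_
  filter_upwards [h1] with x hx
  simp_rw [fourier_comp_smul_latticePoint v hc, smul_add, smul_latticePoint, mul_one, mul_assoc,
    tsum_mul_left] at hx
  rw [hx]
  simp_rw [← character_smul, smul_latticePoint, mul_one_div_cancel hc.ne']

/-- Parseval's identity for periodizations. -/
theorem hasSum_fourier_mul_conj_fourier {u v : EuclideanSpace ℝ (Fin d) → ℂ} (hu : Integrable u)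
    (hv : Integrable v) {c : ℝ} (hc : 0 < c)
    (hs : Summable fun m : Fin d → ℤ => ‖𝓕 v (latticePoint (1 / c) m)‖) :
    HasSum (fun m : Fin d → ℤ => 𝓕 u (latticePoint (1 / c) m) *
      conj (𝓕 v (latticePoint (1 / c) m)))
      (((c ^ d : ℝ) : ℂ) * ∫ x, u x * conj (∑' k : Fin d → ℤ, v (x + latticePoint c k))) := by
  have hcd : ((c ^ d : ℝ) : ℂ) ≠ 0 := by exact_mod_cast (pow_pos hc d).ne'
  -- These are the terms obtained by inserting the Poisson expansion of the periodization of `v`.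
  -- Their `L^1` norms are `‖u‖_1 |𝓕 v(m/c)|`, so no decay of `u` or of `𝓕 u` is needed.
  let F : (Fin d → ℤ) → EuclideanSpace ℝ (Fin d) → ℂ := fun m x => u x *
    conj (character (latticePoint (1 / c) m) x) * conj (𝓕 v (latticePoint (1 / c) m))
  have hF : ∀ m, Integrable (F m) := fun m => by
    exact (hu.mul_conj_character _).mul_const _
  have hFn : ∀ m, ∫ x, ‖F m x‖ = (∫ x, ‖u x‖) * ‖𝓕 v (latticePoint (1 / c) m)‖ := fun m => by
    simp_rw [F, norm_mul, RCLike.norm_conj, norm_character, mul_one, integral_mul_const]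
  have h1 := hasSum_integral_of_summable_integral_norm hF (by
    simp_rw [hFn]
    exact hs.mul_left _)
  have h2 : ∀ m, ∫ x, F m x = 𝓕 u (latticePoint (1 / c) m) *
      conj (𝓕 v (latticePoint (1 / c) m)) := fun m => by
    simp_rw [F, integral_mul_const]
    rw [fourier_eq_integral_character u]
  simp_rw [h2] at h1
  refine (congrArg (HasSum _) ?_).mpr h1
  rw [← integral_const_mul]
  refine integral_congr_ae ?_
  filter_upwards [ae_tsum_translate_eq hv hc hs] with x hx
  rw [hx]
  simp_rw [F, mul_assoc, tsum_mul_left, map_mul, map_inv₀, Complex.conj_ofReal, Complex.conj_tsum]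
  simp_rw [map_mul]
  rw [mul_left_comm, mul_inv_cancel_left₀ hcd]
  simp_rw [mul_comm]

end Poisson

/-! ### The windowed Fourier transform and Moyal's identity -/

section WindowedFourier

variable {d : ℕ}

theorem windowedFourier_eq_fourier (g f : EuclideanSpace ℝ (Fin d) → ℂ)
    (z : EuclideanSpace ℝ (Fin d) × EuclideanSpace ℝ (Fin d)) :
    windowedFourier g f z = 𝓕 (fun x => f x * conj (g (x - z.1))) z.2 := by
  rw [fourier_eq_integral_character, windowedFourier, pairing]
  congr 1
  funext x
  simp only [tfShift, modulateFn, translateFn, map_mul]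
  ring

theorem memLp_translate {f : EuclideanSpace ℝ (Fin d) → ℂ} (hf : MemLp f 2)
    (t : EuclideanSpace ℝ (Fin d)) : MemLp (fun x => f (x - t)) 2 :=
  hf.comp_measurePreserving (measurePreserving_sub_right volume t)

theorem memLp_conj {f : EuclideanSpace ℝ (Fin d) → ℂ} (hf : MemLp f 2) :
    MemLp (fun x => conj (f x)) 2 :=
  hf.star

theorem memLp_tfShift {f : EuclideanSpace ℝ (Fin d) → ℂ} (hf : MemLp f 2)
    (t ω : EuclideanSpace ℝ (Fin d)) : MemLp (tfShift t ω f) 2 := by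
  refine (memLp_translate hf t).of_le (aestronglyMeasurable_modulate ω
    (aestronglyMeasurable_translate t hf.1)) (Filter.Eventually.of_forall fun x => ?_)
  simp [tfShift, modulateFn, translateFn, norm_character]

theorem integrable_mul_conj {f g : EuclideanSpace ℝ (Fin d) → ℂ} (hf : MemLp f 2)
    (hg : MemLp g 2) : Integrable fun x => f x * conj (g x) :=
  hf.integrable_mul (memLp_conj hg)

theorem integrable_mul_conj_translate {f g : EuclideanSpace ℝ (Fin d) → ℂ} (hf : MemLp f 2)
    (hg : MemLp g 2) (t : EuclideanSpace ℝ (Fin d)) :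
    Integrable fun x => f x * conj (g (x - t)) :=
  integrable_mul_conj hf (memLp_translate hg t)

theorem exists_norm_windowedFourier_le {f g : EuclideanSpace ℝ (Fin d) → ℂ} (hf : MemLp f 2)
    (hg : MemLp g 2) : ∃ C : ℝ, ∀ z, ‖windowedFourier g f z‖ ≤ C := by
  -- A crude bound from `st ≤ s² + t²`; only boundedness matters.
  refine ⟨(∫ x, ‖f x‖ ^ 2) + ∫ x, ‖g x‖ ^ 2, fun z => ?_⟩
  have h1 : Integrable fun x => ‖f x‖ ^ 2 := hf.integrable_norm_pow two_ne_zero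
  have h2 : Integrable fun x => ‖g x‖ ^ 2 := hg.integrable_norm_pow two_ne_zero
  have h3 := h2.comp_sub_right z.1
  rw [windowedFourier_eq_fourier]
  refine (norm_fourier_le _).trans ?_
  rw [← integral_sub_right_eq_self (fun x => ‖g x‖ ^ 2) z.1, ← integral_add h1 h3]
  refine integral_mono (integrable_mul_conj_translate hf hg z.1).norm (h1.add h3) fun x => ?_
  simp only [norm_mul, RCLike.norm_conj]
  nlinarith [sq_nonneg (‖f x‖ - ‖g (x - z.1)‖), norm_nonneg (f x), norm_nonneg (g (x - z.1)),
    mul_nonneg (norm_nonneg (f x)) (norm_nonneg (g (x - z.1)))]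

theorem pairing_congr {f f' h h' : EuclideanSpace ℝ (Fin d) → ℂ} (hf : f =ᵐ[volume] f')
    (hh : h =ᵐ[volume] h') : pairing f h = pairing f' h' := by
  refine integral_congr_ae ?_
  filter_upwards [hf, hh] with x h1 h2
  rw [h1, h2]

theorem translate_congr {f f' : EuclideanSpace ℝ (Fin d) → ℂ} (hf : f =ᵐ[volume] f')
    (t : EuclideanSpace ℝ (Fin d)) : translateFn t f =ᵐ[volume] translateFn t f' :=
  (measurePreserving_sub_right volume t).quasiMeasurePreserving.ae_eq_comp hf

theorem modulate_congr {f f' : EuclideanSpace ℝ (Fin d) → ℂ} (hf : f =ᵐ[volume] f')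
    (ω : EuclideanSpace ℝ (Fin d)) : modulateFn ω f =ᵐ[volume] modulateFn ω f' :=
  hf.mono fun x hx => by rw [modulateFn, modulateFn, hx]

theorem windowedFourier_congr {f f' g g' : EuclideanSpace ℝ (Fin d) → ℂ} (hf : f =ᵐ[volume] f')
    (hg : g =ᵐ[volume] g') : windowedFourier g f = windowedFourier g' f' :=
  funext fun _ => pairing_congr hf (modulate_congr (translate_congr hg _) _)

/-- The transform depends only on a.e. classes, so measurable representatives can be used; the
integrand is then jointly measurable. -/
theorem stronglyMeasurable_windowedFourier {f g : EuclideanSpace ℝ (Fin d) → ℂ}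
    (hf : AEStronglyMeasurable f volume) (hg : AEStronglyMeasurable g volume) :
    StronglyMeasurable (windowedFourier g f) := by
  rw [windowedFourier_congr hf.ae_eq_mk hg.ae_eq_mk]
  refine StronglyMeasurable.integral_prod_right' (f := fun p : (EuclideanSpace ℝ (Fin d) ×
    EuclideanSpace ℝ (Fin d)) × EuclideanSpace ℝ (Fin d) =>
    hf.mk f p.2 * conj (tfShift p.1.1 p.1.2 (hg.mk g) p.2)) ?_
  refine (hf.stronglyMeasurable_mk.comp_measurable measurable_snd).mul ?_
  refine Complex.continuous_conj.comp_stronglyMeasurable ?_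
  unfold tfShift modulateFn translateFn character
  refine StronglyMeasurable.mul (Continuous.stronglyMeasurable (by fun_prop)) ?_
  exact hg.stronglyMeasurable_mk.comp_measurable (by fun_prop)

theorem pairing_conj (f h : EuclideanSpace ℝ (Fin d) → ℂ) : conj (pairing f h) = pairing h f := by
  rw [pairing, pairing, ← integral_conj]
  congr 1
  funext x
  simp [mul_comm]

/-- Moyal's identity. -/
theorem integral_windowedFourier_mul_conj {f a f' a' : EuclideanSpace ℝ (Fin d) → ℂ}
    (hf : MemLp f 2) (ha : MemLp a 2) (hf' : MemLp f' 2) (ha' : MemLp a' 2)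
    (hV : Integrable (windowedFourier a' f')) :
    ∫ z, windowedFourier a f z * conj (windowedFourier a' f' z) =
      pairing f f' * conj (pairing a a') := by
  obtain ⟨C, hC⟩ := exists_norm_windowedFourier_le hf ha
  have hVc : Integrable fun z => conj (windowedFourier a' f' z) :=
    Complex.conjCLE.toContinuousLinearMap.integrable_comp hV
  have hint : Integrable fun z => windowedFourier a f z * conj (windowedFourier a' f' z) :=
    hVc.bdd_mul (stronglyMeasurable_windowedFourier hf.1 ha.1).aestronglyMeasurable
      (Filter.Eventually.of_forall hC)
  rw [Measure.volume_eq_prod] at hint hV ⊢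
  rw [integral_prod _ hint]
  -- Parseval in the frequency variable; it applies for almost every `t`, namely where the section
  -- of `F_{a'} f'` is integrable.
  have h1 : ∀ᵐ t, ∫ ω, windowedFourier a f (t, ω) * conj (windowedFourier a' f' (t, ω)) =
      ∫ x, f x * conj (f' x) * (a' (x - t) * conj (a (x - t))) := by
    filter_upwards [hV.prod_right_ae] with t ht
    simp_rw [windowedFourier_eq_fourier] at ht ⊢
    rw [integral_fourier_mul_conj_fourier (integrable_mul_conj_translate hf ha t)
      (integrable_mul_conj_translate hf' ha' t) ht]
    congr 1
    funext x
    simp only [map_mul, RingHomCompTriple.comp_apply, RingHom.id_apply]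
    ring
  rw [integral_congr_ae h1]
  -- The remaining integrand has the form `φ(x) ψ(x - t)` with `φ` and `ψ` integrable, which
  -- licenses Fubini.
  have h2 := (integrable_mul_conj hf hf').convolution_integrand (ContinuousLinearMap.mul ℝ ℂ)
    (integrable_mul_conj ha' ha).comp_neg
  simp only [ContinuousLinearMap.mul_apply', neg_sub] at h2
  rw [integral_integral_swap h2]
  simp_rw [integral_const_mul]
  have h3 : ∀ x, ∫ t, a' (x - t) * conj (a (x - t)) = conj (pairing a a') := by
    intro x
    rw [integral_sub_left_eq_self (fun y => a' y * conj (a y)) volume x, pairing_conj]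
    rfl
  simp_rw [h3, integral_mul_const]
  rfl

/-- Time-frequency shifts of signal and window act on the transform as phase-space translations, up
to a unimodular factor that the modulus discards. -/
theorem norm_windowedFourier_tfShift (h₁ h₂ : EuclideanSpace ℝ (Fin d) → ℂ)
    (z w ζ : EuclideanSpace ℝ (Fin d) × EuclideanSpace ℝ (Fin d)) :
    ‖windowedFourier (tfShift w.1 w.2 h₂) (tfShift z.1 z.2 h₁) ζ‖ =
      ‖windowedFourier h₂ h₁ (ζ + w - z)‖ := by
  have : windowedFourier (tfShift w.1 w.2 h₂) (tfShift z.1 z.2 h₁) ζ =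
      (character z.2 z.1 * conj (character ζ.2 z.1) * conj (character w.2 (z.1 - ζ.1))) *
        windowedFourier h₂ h₁ (ζ + w - z) := by
    rw [windowedFourier, windowedFourier, pairing, pairing, ← integral_const_mul,
      ← integral_add_right_eq_self _ z.1]
    congr 1
    funext x
    have h4 : x + z.1 - ζ.1 - w.1 = x - (ζ + w - z).1 := by
      simp only [Prod.fst_sub, Prod.fst_add]; abel
    simp only [tfShift, modulateFn, translateFn, add_sub_cancel_right, h4, map_mul,
      conj_character]
    rw [show x + z.1 - ζ.1 = x + (z.1 - ζ.1) by abel]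
    simp only [Prod.snd_add, character_add, neg_add_rev, sub_eq_add_neg, character_add_left,
      Prod.snd_neg, neg_neg]
    ring
  rw [this]
  simp [norm_character]

/-- The left side is the modulus of the right side of Moyal's identity for the shifted functions
`τ(z) h₁` and `τ(w) h₂`; covariance rewrites the integrand. This pointwise bound is the means of
changing windows. -/
theorem enorm_windowedFourier_mul_le {f a h₁ h₂ : EuclideanSpace ℝ (Fin d) → ℂ}
    (hf : MemLp f 2) (ha : MemLp a 2) (h1 : MemLp h₁ 2) (h2 : MemLp h₂ 2)
    (hV : Integrable (windowedFourier h₂ h₁))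
    (z w : EuclideanSpace ℝ (Fin d) × EuclideanSpace ℝ (Fin d)) :
    ‖windowedFourier h₁ f z‖ₑ * ‖windowedFourier h₂ a w‖ₑ ≤
      ∫⁻ ζ, ‖windowedFourier a f ζ‖ₑ * ‖windowedFourier h₂ h₁ (ζ + w - z)‖ₑ := by
  have hm1 := memLp_tfShift h1 z.1 z.2
  have hm2 := memLp_tfShift h2 w.1 w.2
  have hV' : Integrable (windowedFourier (tfShift w.1 w.2 h₂) (tfShift z.1 z.2 h₁)) := by
    refine ((hV.comp_add_right (w - z)).norm).mono'
      (stronglyMeasurable_windowedFourier hm1.1 hm2.1).aestronglyMeasurable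
      (Filter.Eventually.of_forall fun ζ => ?_)
    rw [norm_windowedFourier_tfShift, add_sub_assoc]
  have h := integral_windowedFourier_mul_conj hf ha hm1 hm2 hV'
  have h3 : ‖windowedFourier h₁ f z‖ₑ * ‖windowedFourier h₂ a w‖ₑ =
      ‖pairing f (tfShift z.1 z.2 h₁) * conj (pairing a (tfShift w.1 w.2 h₂))‖ₑ := by
    rw [enorm_mul, RCLike.enorm_conj]
    rfl
  rw [h3, ← h]
  refine (enorm_integral_le_lintegral_enorm _).trans (le_of_eq ?_)
  congr 1
  funext ζ
  rw [enorm_mul, RCLike.enorm_conj, ← ofReal_norm (windowedFourier (tfShift w.1 w.2 h₂) _ ζ),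
    norm_windowedFourier_tfShift, ofReal_norm]

/-- The windowed Fourier transform of a function in `S_0` with a window in `S_0` is integrable. -/
theorem MemS0.integrable_windowedFourier {f h : EuclideanSpace ℝ (Fin d) → ℂ} (hf : MemS0 f)
    (hh : MemS0 h) : Integrable (windowedFourier h f) := by
  -- If the transform is nonzero at some `w`, the product estimate with `a = f` and both windows `h`
  -- is integrated in `z`: the bound is `‖F_f f‖_1 ‖F_h h‖_1`, and the fixed nonzero factor is
  -- divided out.
  by_cases hw : ∃ w, windowedFourier h f w ≠ 0
  · obtain ⟨w, hw⟩ := hw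
    refine ⟨(stronglyMeasurable_windowedFourier hf.1.1 hh.1.1).aestronglyMeasurable, ?_⟩
    have hw0 : ‖windowedFourier h f w‖ₑ ≠ 0 := by simpa using hw
    have h1 : (∫⁻ z, ‖windowedFourier h f z‖ₑ) * ‖windowedFourier h f w‖ₑ < ∞ := by
      have hmf := (stronglyMeasurable_windowedFourier hf.1.1 hf.1.1).measurable.enorm
      have hmh := (stronglyMeasurable_windowedFourier hh.1.1 hh.1.1).measurable.enorm
      rw [← lintegral_mul_const'' _
        (stronglyMeasurable_windowedFourier hf.1.1 hh.1.1).measurable.enorm.aemeasurable]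
      refine (lintegral_mono fun z => enorm_windowedFourier_mul_le hf.1 hf.1 hh.1 hh.1 hh.2
        z w).trans_lt ?_
      rw [lintegral_lintegral_swap]
      · have h2 : ∀ ζ, ∫⁻ z, ‖windowedFourier f f ζ‖ₑ * ‖windowedFourier h h (ζ + w - z)‖ₑ =
            ‖windowedFourier f f ζ‖ₑ * ∫⁻ z, ‖windowedFourier h h z‖ₑ := by
          intro ζ
          rw [lintegral_const_mul _ (by exact hmh.comp (measurable_const.sub measurable_id)),
            lintegral_sub_left_eq_self
            (fun z => ‖windowedFourier h h z‖ₑ)]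
        simp_rw [h2]
        rw [lintegral_mul_const _ hmf]
        exact ENNReal.mul_lt_top hf.2.2 hh.2.2
      · exact ((hmf.comp measurable_snd).mul (hmh.comp
          ((measurable_snd.add_const w).sub measurable_fst))).aemeasurable
    exact (ENNReal.lt_top_of_mul_ne_top_left h1.ne hw0)
  · push Not at hw
    have : windowedFourier h f = fun _ => 0 := funext hw
    rw [this]
    exact integrable_zero _ _ _

theorem MemS0.timeFreqShift {f : EuclideanSpace ℝ (Fin d) → ℂ} (hf : MemS0 f)
    (t ω : EuclideanSpace ℝ (Fin d)) : MemS0 (tfShift t ω f) := by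
  have hm := memLp_tfShift hf.1 t ω
  refine ⟨hm, hf.2.norm.mono' (stronglyMeasurable_windowedFourier hm.1 hm.1).aestronglyMeasurable
    (Filter.Eventually.of_forall fun z => ?_)⟩
  have := norm_windowedFourier_tfShift f f (t, ω) (t, ω) z
  rw [add_sub_cancel_right] at this
  exact this.le

end WindowedFourier

/-! ### The Gaussian and consequences for Feichtinger's algebra -/

section Gaussian

variable {d : ℕ}

theorem supIntegrable_gaussian (V : Type*) [NormedAddCommGroup V] [InnerProductSpace ℝ V]
    [FiniteDimensional ℝ V] [MeasurableSpace V] [BorelSpace V] {c : ℝ} (hc : 0 < c) :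
    SupIntegrable fun x : V => ENNReal.ofReal (Real.exp (-c * ‖x‖ ^ 2)) := by
  intro R
  -- From `‖z‖² ≤ 2‖y‖² + 2R²` for `y` within `R` of `z`: half of the decay rate is given up at the
  -- cost of the factor `e^{cR²}`.
  have hint : Integrable fun x : V => Real.exp (c * R ^ 2) * Real.exp (-(c / 2) * ‖x‖ ^ 2) := by
    have := GaussianFourier.integrable_cexp_neg_mul_sq_norm_add (V := V) (b := ((c / 2 : ℝ) : ℂ))
      (by rw [Complex.ofReal_re]; positivity) 0 0
    refine Integrable.const_mul ?_ _
    refine this.norm.congr (Filter.Eventually.of_forall fun x => ?_)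
    simp only [Complex.norm_exp]
    congr 1
    simp [← Complex.ofReal_pow]
  refine (lintegral_mono fun z => localSup_le fun y hy => ?_).trans_lt hint.lintegral_lt_top
  rw [← Real.exp_add]
  refine ENNReal.ofReal_le_ofReal (Real.exp_le_exp.2 ?_)
  rw [dist_eq_norm] at hy
  have h1 : ‖z‖ ≤ ‖y‖ + ‖y - z‖ := by
    calc ‖z‖ = ‖y - (y - z)‖ := by congr 1; abel
      _ ≤ _ := norm_sub_le _ _
  have h2 : ‖y - z‖ ^ 2 ≤ R ^ 2 := by gcongr
  have h3 : ‖z‖ ^ 2 ≤ 2 * ‖y‖ ^ 2 + 2 * R ^ 2 := by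
    nlinarith [sq_nonneg (‖y‖ - ‖y - z‖), norm_nonneg z, norm_nonneg y, norm_nonneg (y - z)]
  nlinarith

/-- Balls of the maximum metric are products of balls, so the local supremum is at most the product
of the local suprema. -/
theorem SupIntegrable.prod_mul {X Y : Type*} [NormedAddCommGroup X] [MeasureSpace X] [BorelSpace X]
    [NormedAddCommGroup Y] [MeasureSpace Y] [BorelSpace Y]
    [SFinite (volume : Measure X)] [SFinite (volume : Measure Y)] {F : X → ℝ≥0∞} {G : Y → ℝ≥0∞}
    (hF : SupIntegrable F) (hG : SupIntegrable G) :
    SupIntegrable fun p : X × Y => F p.1 * G p.2 := by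
  intro R
  have h1 := lintegral_prod_mul (μ := (volume : Measure X)) (ν := (volume : Measure Y))
    (measurable_localSup R F).aemeasurable (measurable_localSup R G).aemeasurable
  refine lt_of_le_of_lt (lintegral_mono fun p => localSup_le fun y hy => ?_)
    (h1.trans_lt (ENNReal.mul_lt_top (hF R) (hG R)))
  rw [Prod.dist_eq, max_lt_iff] at hy
  exact mul_le_mul' (le_localSup hy.1) (le_localSup hy.2)

/-- The Gaussian `e^{-π |x|²}`. -/
def gaussian (x : EuclideanSpace ℝ (Fin d)) : ℂ := Complex.exp (-(Real.pi : ℂ) * (‖x‖ : ℂ) ^ 2)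

theorem norm_gaussian (x : EuclideanSpace ℝ (Fin d)) :
    ‖gaussian x‖ = Real.exp (-Real.pi * ‖x‖ ^ 2) := by
  rw [gaussian, Complex.norm_exp]
  congr 1
  simp [← Complex.ofReal_pow]

theorem continuous_gaussian : Continuous (gaussian (d := d)) := by
  unfold gaussian
  fun_prop

theorem gaussian_ne_zero (x : EuclideanSpace ℝ (Fin d)) : gaussian x ≠ 0 := Complex.exp_ne_zero _

theorem conj_gaussian (x : EuclideanSpace ℝ (Fin d)) : conj (gaussian x) = gaussian x := by
  rw [gaussian, ← Complex.exp_conj]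
  simp

theorem gaussian_neg (x : EuclideanSpace ℝ (Fin d)) : gaussian (-x) = gaussian x := by
  simp [gaussian]

theorem supIntegrable_enorm_gaussian : SupIntegrable fun x => ‖gaussian (d := d) x‖ₑ := by
  have := supIntegrable_gaussian (EuclideanSpace ℝ (Fin d)) Real.pi_pos
  simpa only [← ofReal_norm, norm_gaussian] using this

theorem memLp_gaussian : MemLp (gaussian (d := d)) 2 := by
  refine (memLp_two_iff_integrable_sq_norm continuous_gaussian.aestronglyMeasurable).2 ?_
  have := (supIntegrable_gaussian (EuclideanSpace ℝ (Fin d)) (c := 2 * Real.pi)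
    (by positivity)).lintegral_lt_top
  refine ⟨(continuous_gaussian.norm.pow 2).aestronglyMeasurable, ?_⟩
  refine lt_of_eq_of_lt ?_ this
  congr 1
  funext x
  rw [← ofReal_norm]
  simp only [norm_pow, norm_norm]
  rw [norm_gaussian, ← Real.exp_nat_mul]
  push_cast
  ring_nf

theorem norm_windowedFourier_gaussian (z : EuclideanSpace ℝ (Fin d) × EuclideanSpace ℝ (Fin d)) :
    ‖windowedFourier gaussian gaussian z‖ = ‖((Real.pi : ℂ) / ((2 * Real.pi : ℝ) : ℂ)) ^ (d / 2 : ℂ)‖ *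
      (Real.exp (-(Real.pi / 2) * ‖z.1‖ ^ 2) * Real.exp (-(Real.pi / 2) * ‖z.2‖ ^ 2)) := by
  -- Shifting by half of `z.1` centres the two Gaussians symmetrically. By the parallelogram law
  -- their product is `e^{-2π|x|²}` times a constant in `x`, which reduces the claim to the Fourier
  -- transform of a Gaussian.
  let y : EuclideanSpace ℝ (Fin d) := (1 / 2 : ℝ) • z.1
  have h1 := fourier_gaussian_innerProductSpace (V := EuclideanSpace ℝ (Fin d))
    (b := ((2 * Real.pi : ℝ) : ℂ)) (by rw [Complex.ofReal_re]; positivity) z.2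
  have h2 : windowedFourier gaussian gaussian z = (Complex.exp (-(Real.pi / 2 : ℝ) * (‖z.1‖ : ℂ) ^ 2)
      * conj (character z.2 y)) * 𝓕 (fun v : EuclideanSpace ℝ (Fin d) =>
        Complex.exp (-((2 * Real.pi : ℝ) : ℂ) * (‖v‖ : ℂ) ^ 2)) z.2 := by
    rw [windowedFourier_eq_fourier, fourier_eq_integral_character, fourier_eq_integral_character,
      ← integral_const_mul, ← integral_add_right_eq_self _ y]
    congr 1
    funext x
    rw [character_add, map_mul, conj_gaussian, gaussian, gaussian, ← Complex.exp_add]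
    have h3 : Complex.exp (-(Real.pi : ℂ) * (‖x + y‖ : ℂ) ^ 2 +
        -(Real.pi : ℂ) * (‖x + y - z.1‖ : ℂ) ^ 2) =
        Complex.exp (-(Real.pi / 2 : ℝ) * (‖z.1‖ : ℂ) ^ 2) *
          Complex.exp (-((2 * Real.pi : ℝ) : ℂ) * (‖x‖ : ℂ) ^ 2) := by
      rw [← Complex.exp_add]
      congr 1
      have h4 : x + y - z.1 = x - y := by
        simp only [y]
        module
      have h5 : ‖x + y‖ ^ 2 + ‖x - y‖ ^ 2 = 2 * ‖x‖ ^ 2 + ‖z.1‖ ^ 2 / 2 := by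
        have := parallelogram_law_with_norm ℝ x y
        have h6 : ‖y‖ = ‖z.1‖ / 2 := by
          simp only [y, norm_smul]
          norm_num
          ring
        rw [h6] at this
        nlinarith
      rw [h4]
      have h7 : (‖x + y‖ : ℂ) ^ 2 + (‖x - y‖ : ℂ) ^ 2 = 2 * (‖x‖ : ℂ) ^ 2 + (‖z.1‖ : ℂ) ^ 2 / 2 := by
        exact_mod_cast h5
      push_cast
      linear_combination (-(Real.pi : ℂ)) * h7
    rw [h3]
    ring
  rw [h2, h1, norm_mul, norm_mul, norm_mul, RCLike.norm_conj, norm_character, mul_one,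
    Complex.norm_exp, Complex.norm_exp, finrank_euclideanSpace_fin]
  have h8 : (-(Real.pi : ℂ) ^ 2 * (‖z.2‖ : ℂ) ^ 2 / ((2 * Real.pi : ℝ) : ℂ)).re =
      -(Real.pi / 2) * ‖z.2‖ ^ 2 := by
    rw [← Complex.ofReal_re (-(Real.pi / 2) * ‖z.2‖ ^ 2)]
    congr 1
    have : (Real.pi : ℂ) ≠ 0 := by exact_mod_cast Real.pi_ne_zero
    push_cast
    field_simp
  have h9 : (-((Real.pi / 2 : ℝ) : ℂ) * (‖z.1‖ : ℂ) ^ 2).re = -(Real.pi / 2) * ‖z.1‖ ^ 2 := by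
    rw [← Complex.ofReal_re (-(Real.pi / 2) * ‖z.1‖ ^ 2)]
    congr 1
    push_cast
    ring
  rw [h8, h9]
  ring

theorem supIntegrable_windowedFourier_gaussian :
    SupIntegrable fun z => ‖windowedFourier (gaussian (d := d)) gaussian z‖ₑ := by
  have h1 := supIntegrable_gaussian (EuclideanSpace ℝ (Fin d)) (c := Real.pi / 2) (by positivity)
  have h2 := (h1.prod_mul h1).const_mul
    (C := ENNReal.ofReal ‖((Real.pi : ℂ) / ((2 * Real.pi : ℝ) : ℂ)) ^ (d / 2 : ℂ)‖)
    ENNReal.ofReal_ne_top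
  refine h2.mono fun z => le_of_eq ?_
  rw [← ofReal_norm, norm_windowedFourier_gaussian, ENNReal.ofReal_mul (norm_nonneg _),
    ENNReal.ofReal_mul (Real.exp_nonneg _)]

theorem memS0_gaussian : MemS0 (gaussian (d := d)) :=
  ⟨memLp_gaussian, (stronglyMeasurable_windowedFourier memLp_gaussian.1
    memLp_gaussian.1).aestronglyMeasurable, supIntegrable_windowedFourier_gaussian.lintegral_lt_top⟩

theorem lintegral_enorm_gaussian_mul_self_ne_zero :
    ∫⁻ x, ‖gaussian (d := d) x‖ₑ * ‖gaussian (d := d) x‖ₑ ≠ 0 := by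
  have hm : Measurable fun x => ‖gaussian (d := d) x‖ₑ * ‖gaussian (d := d) x‖ₑ :=
    continuous_gaussian.measurable.enorm.mul continuous_gaussian.measurable.enorm
  rw [Ne, lintegral_eq_zero_iff hm]
  intro h
  obtain ⟨x, hx⟩ := h.exists
  simp [gaussian_ne_zero] at hx

theorem windowedFourier_gaussian_zero_ne_zero :
    windowedFourier (gaussian (d := d)) gaussian (0, 0) ≠ 0 := by
  have h := norm_windowedFourier_gaussian (d := d) (0, 0)
  intro h0
  rw [h0] at h
  have h1 : ((Real.pi : ℂ) / ((2 * Real.pi : ℝ) : ℂ)) ^ (d / 2 : ℂ) ≠ 0 := by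
    rw [Complex.cpow_ne_zero_iff]
    left
    have : (Real.pi : ℂ) ≠ 0 := by exact_mod_cast Real.pi_ne_zero
    push_cast
    simp [this]
  exact mul_ne_zero (norm_ne_zero_iff.2 h1) (mul_ne_zero (Real.exp_ne_zero _)
    (Real.exp_ne_zero _)) (h.symm.trans norm_zero)

/-- The product estimate at `w = 0` with `a = h₂ = k` dominates `|F_h f|` by a convolution of `|F_k
f| ∈ L^1` with `|F_k h|`, after division by `|F_k k(0)|`. -/
theorem MemS0.supIntegrable_of_window {f h k : EuclideanSpace ℝ (Fin d) → ℂ} (hf : MemS0 f)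
    (hh : MemS0 h) (hk : MemS0 k) (hk0 : windowedFourier k k (0, 0) ≠ 0)
    (hF : SupIntegrable fun z => ‖windowedFourier k h z‖ₑ) :
    SupIntegrable fun z => ‖windowedFourier h f z‖ₑ := by
  have h1 := hf.integrable_windowedFourier hk
  have h2 : SupIntegrable fun z => ‖windowedFourier k k (0, 0)‖ₑ * ‖windowedFourier h f z‖ₑ := by
    refine hF.conv h1.1.enorm h1.2 fun z => ?_
    have := enorm_windowedFourier_mul_le hf.1 hk.1 hh.1 hk.1 (hh.integrable_windowedFourier hk)
      z (0, 0)
    rw [mul_comm]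
    simpa only [Prod.mk_zero_zero, add_zero] using this
  have hne : ‖windowedFourier k k (0, 0)‖ₑ ≠ 0 := by simpa using hk0
  refine (h2.const_mul (C := ‖windowedFourier k k (0, 0)‖ₑ⁻¹) (by simpa using hk0)).mono
    fun z => le_of_eq ?_
  rw [← mul_assoc, ENNReal.inv_mul_cancel hne enorm_ne_top, one_mul]

/-- The windowed Fourier transform of functions in `S_0` belongs to `W(L^∞, ℓ^1)`. -/
theorem MemS0.supIntegrable_windowedFourier {f h : EuclideanSpace ℝ (Fin d) → ℂ} (hf : MemS0 f)
    (hh : MemS0 h) : SupIntegrable fun z => ‖windowedFourier h f z‖ₑ :=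
  -- Two changes of window: from the explicit transform of the Gaussian to `F_φ h` with `φ`
  -- Gaussian, and from there to `F_h f`.
  hf.supIntegrable_of_window hh memS0_gaussian windowedFourier_gaussian_zero_ne_zero
    (hh.supIntegrable_of_window memS0_gaussian memS0_gaussian windowedFourier_gaussian_zero_ne_zero
      supIntegrable_windowedFourier_gaussian)

/-- Integrating the bound in `t` against the Gaussian frees `F x` from the window. The a.e.
quantifiers in `t` and `x` must be exchanged first, hence the measurability hypotheses. -/
theorem ae_le_of_ae_mul_gaussian_le {F G : EuclideanSpace ℝ (Fin d) → ℝ≥0∞} (hF : Measurable F)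
    (hG : Measurable G) (h : ∀ᵐ t, ∀ᵐ x, F x * ‖gaussian (x - t)‖ₑ ≤ G t) :
    ∀ᵐ x, F x * (∫⁻ y, ‖gaussian (d := d) y‖ₑ * ‖gaussian y‖ₑ) ≤
      ∫⁻ t, G t * ‖gaussian (t - x)‖ₑ := by
  have hg : Measurable fun x => ‖gaussian (d := d) x‖ₑ := continuous_gaussian.measurable.enorm
  have hs : MeasurableSet {p : EuclideanSpace ℝ (Fin d) × EuclideanSpace ℝ (Fin d) |
      F p.2 * ‖gaussian (p.2 - p.1)‖ₑ ≤ G p.1} :=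
    measurableSet_le ((hF.comp measurable_snd).mul (hg.comp (measurable_snd.sub measurable_fst)))
      (hG.comp measurable_fst)
  have h2 := (Measure.ae_ae_comm hs).1 h
  filter_upwards [h2] with x hx
  have hgx : Measurable fun t => ‖gaussian (x - t)‖ₑ := hg.comp (measurable_const.sub measurable_id)
  rw [← lintegral_sub_left_eq_self (fun y => ‖gaussian y‖ₑ * ‖gaussian y‖ₑ) x,
    ← lintegral_const_mul _ (by exact hgx.mul hgx)]
  refine lintegral_mono_ae ?_
  filter_upwards [hx] with t ht
  rw [← mul_assoc, ← gaussian_neg (t - x), neg_sub]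
  gcongr

/-- Functions in `S_0` belong to `W(L^∞, ℓ^1)`. -/
theorem MemS0.exists_supIntegrable_bound {f : EuclideanSpace ℝ (Fin d) → ℂ} (hf : MemS0 f) :
    ∃ H : EuclideanSpace ℝ (Fin d) → ℝ≥0∞, Measurable H ∧ SupIntegrable H ∧
      ∀ᵐ x, ‖f x‖ₑ ≤ H x := by
  have hV := hf.integrable_windowedFourier memS0_gaussian
  have hVm := (stronglyMeasurable_windowedFourier hf.1.1
    (memS0_gaussian (d := d)).1.1).measurable.enorm
  rw [Measure.volume_eq_prod] at hV
  let G : EuclideanSpace ℝ (Fin d) → ℝ≥0∞ := fun t => ∫⁻ ω, ‖windowedFourier gaussian f (t, ω)‖ₑ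
  have hGm : Measurable G := hVm.lintegral_prod_right'
  have hGi : ∫⁻ t, G t < ∞ := by
    have := hV.2
    rwa [HasFiniteIntegral, lintegral_prod _ hVm.aemeasurable] at this
  have hf'm : Measurable fun x => ‖hf.1.1.mk f x‖ₑ := hf.1.1.stronglyMeasurable_mk.measurable.enorm
  -- For almost every `t` the function `f · φ(· - t)`, with `φ` the Gaussian, has an integrable
  -- Fourier transform, so inversion bounds it by `G t`.
  have h1 : ∀ᵐ t, ∀ᵐ x, ‖hf.1.1.mk f x‖ₑ * ‖gaussian (x - t)‖ₑ ≤ G t := by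
    filter_upwards [hV.prod_right_ae] with t ht
    simp_rw [windowedFourier_eq_fourier] at ht
    filter_upwards [ae_enorm_le_lintegral_fourier
      (integrable_mul_conj_translate hf.1 memLp_gaussian t) ht, hf.1.1.ae_eq_mk] with x hx hx'
    rw [enorm_mul, RCLike.enorm_conj, hx'] at hx
    refine hx.trans (le_of_eq ?_)
    simp only [G, windowedFourier_eq_fourier]
  have hc0 := lintegral_enorm_gaussian_mul_self_ne_zero (d := d)
  have hc1 : ∫⁻ x, ‖gaussian (d := d) x‖ₑ * ‖gaussian x‖ₑ ≠ ∞ := by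
    have := integrable_mul_conj (memLp_gaussian (d := d)) memLp_gaussian
    refine ne_of_lt (lt_of_eq_of_lt ?_ this.2)
    simp_rw [enorm_mul, RCLike.enorm_conj]
  have hH : SupIntegrable fun x => ∫⁻ t, G t * ‖gaussian (t - x)‖ₑ :=
    supIntegrable_enorm_gaussian.conv hGm.aemeasurable hGi fun z => le_rfl
  -- A further local supremum makes the bound measurable and keeps it in the class.
  refine ⟨localSup 1 _, measurable_localSup _ _, (hH.const_mul (ENNReal.inv_ne_top.2 hc0)).local_sup 1,
    ?_⟩
  filter_upwards [ae_le_of_ae_mul_gaussian_le hf'm hGm h1, hf.1.1.ae_eq_mk] with x hx hx'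
  refine le_trans ?_ (le_localSup (dist_self x ▸ one_pos))
  rwa [mul_comm, ← div_eq_mul_inv, ENNReal.le_div_iff_mul_le (Or.inl hc0) (Or.inl hc1), hx']

end Gaussian

/-! ### Completeness of the amalgam spaces -/

section Complete

/-- Minkowski's inequality for series of nonnegative functions. -/
theorem eLpNorm_tsum_le {α : Type*} [MeasurableSpace α] {μ : Measure α} {p : ℝ≥0∞} (hp : 1 ≤ p)
    {φ : ℕ → α → ℝ≥0∞} (hφ : ∀ n, AEMeasurable (φ n) μ) :
    eLpNorm (fun x => ∑' n, φ n x) p μ ≤ ∑' n, eLpNorm (φ n) p μ := by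
  by_cases htop : p = ∞
  · subst htop
    rw [eLpNorm_exponent_top]
    refine essSup_le_of_ae_le _ ?_
    have h1 : ∀ᵐ x ∂μ, ∀ n, ‖φ n x‖ₑ ≤ eLpNorm (φ n) ∞ μ :=
      ae_all_iff.2 fun n => ae_le_eLpNormEssSup
    filter_upwards [h1] with x hx
    simp only [enorm_eq_self] at hx ⊢
    exact ENNReal.tsum_le_tsum hx
  · have hp0 : 0 < p.toReal := ENNReal.toReal_pos (zero_lt_one.trans_le hp).ne' htop
    have hs : ∀ N, eLpNorm (fun x => ∑ n ∈ Finset.range N, φ n x) p μ ≤ ∑' n, eLpNorm (φ n) p μ := by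
      intro N
      have := eLpNorm_sum_le (μ := μ) (p := p) (s := Finset.range N) (f := φ)
        (fun n _ => (hφ n).aestronglyMeasurable) hp
      rw [Finset.sum_fn] at this
      exact this.trans (ENNReal.sum_le_tsum _)
    rw [eLpNorm_eq_lintegral_rpow_enorm_toReal (zero_lt_one.trans_le hp).ne' htop]
    simp only [enorm_eq_self]
    -- Monotone convergence: the power of the series is the supremum of the powers of its partial
    -- sums, to which the finite Minkowski inequality applies.
    have h2 : ∀ x, (∑' n, φ n x) ^ p.toReal
        = ⨆ N, (∑ n ∈ Finset.range N, φ n x) ^ p.toReal := by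
      intro x
      rw [ENNReal.tsum_eq_iSup_nat]
      exact (ENNReal.orderIsoRpow p.toReal hp0).map_iSup _
    simp_rw [h2]
    rw [lintegral_iSup' (fun N => ((Finset.aemeasurable_fun_sum _ fun n _ => hφ n).pow_const _)),
      one_div, ENNReal.rpow_inv_le_iff hp0]
    · refine iSup_le fun N => ?_
      have := hs N
      rw [eLpNorm_eq_lintegral_rpow_enorm_toReal (zero_lt_one.trans_le hp).ne' htop, one_div,
        ENNReal.rpow_inv_le_iff hp0] at this
      simpa only [enorm_eq_self] using this
    · refine Filter.Eventually.of_forall fun x M N hMN => ?_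
      dsimp only
      gcongr

variable {d : ℕ} {p q : ℝ≥0∞}

theorem amalgamENorm_tsum_le (hp : 1 ≤ p) (hq : 1 ≤ q) {f : ℕ → EuclideanSpace ℝ (Fin d) → ℂ}
    (hf : ∀ n, AEStronglyMeasurable (f n) volume) :
    amalgamENorm p q (fun x => ∑' n, f n x) ≤ ∑' n, amalgamENorm p q (f n) := by
  unfold amalgamENorm
  refine le_trans (eLpNorm_mono_enorm fun k => ?_) (eLpNorm_tsum_le hq fun n =>
    (measurable_of_countable fun k => eLpNorm ((cube k).indicator (f n)) p volume).aemeasurable)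
  simp only [enorm_eq_self]
  have h1 : ∀ n, eLpNorm ((cube k).indicator (f n)) p volume
      = eLpNorm (fun x => ‖(cube k).indicator (f n) x‖ₑ) p volume := fun n => by
    rw [eLpNorm_enorm]
  simp_rw [h1]
  refine le_trans (eLpNorm_mono_enorm fun x => ?_) (eLpNorm_tsum_le hp fun n =>
    ((hf n).indicator (measurableSet_cube k)).enorm)
  rw [enorm_eq_self]
  by_cases hk : x ∈ cube k
  · simp only [hk, Set.indicator_of_mem]
    exact enorm_tsum_le_tsum_enorm
  · simp [hk]

theorem le_amalgamENorm (hq : 1 ≤ q) (f : EuclideanSpace ℝ (Fin d) → ℂ) (k : Fin d → ℤ) :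
    eLpNorm ((cube k).indicator f) p volume ≤ amalgamENorm p q f := by
  classical
  have h1 : eLpNorm (Set.indicator {k} fun k : Fin d → ℤ => eLpNorm ((cube k).indicator f) p volume) q
      Measure.count ≤ amalgamENorm p q f := eLpNorm_indicator_le _
  refine le_trans (le_of_eq ?_) h1
  have h2 : (Set.indicator {k} fun k : Fin d → ℤ => eLpNorm ((cube k).indicator f) p volume) =
      Set.indicator {k} fun _ => eLpNorm ((cube k).indicator f) p volume := by
    funext j
    by_cases hj : j = k
    · subst hj; simp
    · simp [hj]
  rw [h2, eLpNorm_indicator_const' (measurableSet_singleton k) (by simp) (by positivity)]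
  simp

theorem coeFn_amalgam_sum [Fact (1 ≤ p)] [Fact (1 ≤ q)] {ι : Type*} (s : Finset ι)
    (f : ι → amalgam d p q) : toFn (∑ i ∈ s, f i) =ᵐ[volume] fun x => ∑ i ∈ s, toFn (f i) x := by
  classical
  induction s using Finset.induction_on with
  | empty =>
    simp only [Finset.sum_empty]
    exact AEEqFun.coeFn_zero
  | insert i s hi ih =>
    rw [Finset.sum_insert hi]
    filter_upwards [ih, AEEqFun.coeFn_add (f i : EuclideanSpace ℝ (Fin d) →ₘ[volume] ℂ)
      (∑ j ∈ s, f j : amalgam d p q)] with x h1 h2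
    rw [Finset.sum_insert hi, ← h1]
    exact h2

theorem enorm_amalgam [Fact (1 ≤ p)] [Fact (1 ≤ q)] (f : amalgam d p q) :
    ‖f‖ₑ = amalgamENorm p q (toFn f) := by
  rw [← ofReal_norm, norm_def, ENNReal.ofReal_toReal]
  exact f.2.ne

/-- A Riesz–Fischer argument: an absolutely summable series converges pointwise a.e. on every cube,
and Minkowski's inequality bounds the tails. Completeness is what lets Janssen's series be summed in
the operator norm. -/
instance [hp : Fact (1 ≤ p)] [hq : Fact (1 ≤ q)] : CompleteSpace (amalgam d p q) := by
  refine NormedAddCommGroup.completeSpace_of_summable_imp_tendsto fun u hu => ?_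
  have hm : ∀ n, AEStronglyMeasurable (toFn (u n)) volume := fun n => AEEqFun.aestronglyMeasurable _
  have hu' : ∑' n, amalgamENorm p q (toFn (u n)) ≠ ∞ := by
    simp_rw [← enorm_amalgam]
    exact tsum_enorm_ne_top_iff_summable_norm.2 hu
  have hs : ∀ᵐ x, Summable fun n => toFn (u n) x := by
    have h1 : ∀ᵐ x, ∀ k : Fin d → ℤ, Summable fun n => ‖(cube k).indicator (toFn (u n)) x‖ :=
      ae_all_iff.2 fun k => summable_norm_of_tsum_eLpNorm_ne_top hp.out
        (fun n => (hm n).indicator (measurableSet_cube k))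
        (ne_top_of_le_ne_top hu' (ENNReal.tsum_le_tsum fun n => le_amalgamENorm hq.out _ k))
    filter_upwards [h1] with x hx
    obtain ⟨k, hk⟩ := exists_mem_cube x
    have := hx k
    simp only [Set.indicator_of_mem hk] at this
    exact this.of_norm
  let F : EuclideanSpace ℝ (Fin d) → ℂ := fun x => ∑' n, toFn (u n) x
  have hF : AEStronglyMeasurable F volume :=
    (AEMeasurable.tsum fun n => (hm n).aemeasurable).aestronglyMeasurable
  have hFn : amalgamENorm p q F < ∞ := (amalgamENorm_tsum_le hp.out hq.out hm).trans_lt hu'.lt_top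
  let a : amalgam d p q := ⟨AEEqFun.mk F hF, by
    change amalgamENorm p q _ < ∞
    rwa [amalgamENorm_congr (AEEqFun.coeFn_mk _ _)]⟩
  refine ⟨a, ?_⟩
  rw [tendsto_iff_edist_tendsto_0]
  have htail : ∀ N, edist (∑ n ∈ Finset.range N, u n) a ≤
      ∑' n, amalgamENorm p q (toFn (u (n + N))) := by
    intro N
    rw [edist_comm, edist_eq_enorm_sub, enorm_amalgam]
    refine le_trans (le_of_eq (amalgamENorm_congr ?_)) (amalgamENorm_tsum_le hp.out hq.out
      fun n => hm (n + N))
    filter_upwards [coeFn_amalgam_sum (Finset.range N) u, hs, AEEqFun.coeFn_mk F hF,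
      AEEqFun.coeFn_sub (a : EuclideanSpace ℝ (Fin d) →ₘ[volume] ℂ)
        (∑ n ∈ Finset.range N, u n : amalgam d p q)] with x h1 h2 h3 h4
    have h5 := h2.sum_add_tsum_nat_add N
    refine (h4.trans (congrArg₂ (· - ·) h3 h1)).trans ?_
    rw [sub_eq_iff_eq_add', h5]
  refine tendsto_of_tendsto_of_tendsto_of_le_of_le tendsto_const_nhds
    (ENNReal.tendsto_sum_nat_add _ hu') (fun N => zero_le) htail

end Complete

/-! ### Pairings of amalgam functions with Feichtinger's algebra -/

section Pairing

variable {d : ℕ}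

theorem volume_cube (k : Fin d → ℤ) : volume (cube k) = 1 := by
  rw [← (PiLp.volume_preserving_toLp (Fin d)).measure_preimage
    (measurableSet_cube k).nullMeasurableSet]
  have : WithLp.toLp 2 ⁻¹' cube k = Set.univ.pi fun i => Set.Ico (k i : ℝ) (k i + 1) := by
    ext x
    simp [cube, Set.mem_pi]
  rw [this, Real.volume_pi_Ico]
  simp

theorem dist_lt_of_mem_cube {k : Fin d → ℤ} {x y : EuclideanSpace ℝ (Fin d)} (hx : x ∈ cube k)
    (hy : y ∈ cube k) : dist x y < Real.sqrt d + 1 := by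
  rw [EuclideanSpace.dist_eq]
  refine lt_of_le_of_lt (Real.sqrt_le_sqrt (y := d) ?_) (lt_add_one _)
  calc ∑ i, dist (x i) (y i) ^ 2 ≤ ∑ i : Fin d, (1 : ℝ) := by
        refine Finset.sum_le_sum fun i _ => ?_
        have h1 := hx i
        have h2 := hy i
        have h3 : dist (x i) (y i) ≤ 1 := by
          rw [Real.dist_eq, abs_le]
          constructor <;> linarith
        exact pow_le_one₀ dist_nonneg h3
    _ = d := by simp

theorem disjoint_cube {k l : Fin d → ℤ} (h : k ≠ l) : Disjoint (cube k) (cube l) := by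
  refine Set.disjoint_left.2 fun x hk hl => h (funext fun i => ?_)
  have h1 : ⌊x i⌋ = k i := Int.floor_eq_iff.2 (hk i)
  have h2 : ⌊x i⌋ = l i := Int.floor_eq_iff.2 (hl i)
  rw [← h1, h2]

theorem lintegral_eq_tsum_cube (F : EuclideanSpace ℝ (Fin d) → ℝ≥0∞) :
    ∫⁻ x, F x = ∑' k : Fin d → ℤ, ∫⁻ x in cube k, F x := by
  rw [← lintegral_iUnion measurableSet_cube fun _ _ h => disjoint_cube h,
    Set.eq_univ_of_forall fun x => Set.mem_iUnion.2 (exists_mem_cube x), Measure.restrict_univ]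

/-- The norm of `W(L^1, ℓ^∞)`. -/
def localNorm (f : EuclideanSpace ℝ (Fin d) → ℂ) : ℝ≥0∞ := ⨆ k, ∫⁻ x in cube k, ‖f x‖ₑ

/-- Cubes have volume one, so local `L^1` norms are at most local `L^p` norms. Hence every amalgam
space embeds in `W(L^1, ℓ^∞)`, and the pairings need to be studied only there. -/
theorem localNorm_le_amalgamENorm {p q : ℝ≥0∞} (hp : 1 ≤ p) (hq : 1 ≤ q)
    {f : EuclideanSpace ℝ (Fin d) → ℂ} (hf : AEStronglyMeasurable f volume) :
    localNorm f ≤ amalgamENorm p q f := by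
  refine iSup_le fun k => le_trans ?_ (le_amalgamENorm hq f k)
  have : IsProbabilityMeasure (volume.restrict (cube k)) :=
    ⟨by rw [Measure.restrict_apply_univ, volume_cube]⟩
  rw [eLpNorm_indicator_eq_eLpNorm_restrict (measurableSet_cube k), ← eLpNorm_one_eq_lintegral_enorm]
  exact eLpNorm_le_eLpNorm_of_exponent_le hp hf.restrict

/-- The duality bound between `W(L^1, ℓ^∞)` and `W(L^∞, ℓ^1)`. The radius `√d + 1` exceeds the
diameter of a cube, so on each cube `H` is below the mean of its local supremum. -/
theorem lintegral_mul_le_localNorm {f : EuclideanSpace ℝ (Fin d) → ℂ}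
    (hf : AEStronglyMeasurable f volume) (H : EuclideanSpace ℝ (Fin d) → ℝ≥0∞) :
    ∫⁻ x, ‖f x‖ₑ * H x ≤ localNorm f * ∫⁻ x, localSup (Real.sqrt d + 1) H x := by
  rw [lintegral_eq_tsum_cube, lintegral_eq_tsum_cube (localSup _ H), ← ENNReal.tsum_mul_left]
  refine ENNReal.tsum_le_tsum fun k => ?_
  have h1 : ∀ x ∈ cube k, H x ≤ ∫⁻ z in cube k, localSup (Real.sqrt d + 1) H z := by
    intro x hx
    have h2 : H x = ∫⁻ z in cube k, H x := by
      rw [setLIntegral_const, volume_cube, mul_one]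
    rw [h2]
    exact setLIntegral_mono (measurable_localSup _ H) fun z hz =>
      le_localSup (dist_lt_of_mem_cube hx hz)
  calc ∫⁻ x in cube k, ‖f x‖ₑ * H x
      ≤ ∫⁻ x in cube k, ‖f x‖ₑ * ∫⁻ z in cube k, localSup (Real.sqrt d + 1) H z := by
        refine setLIntegral_mono' (measurableSet_cube k) fun x hx => ?_
        gcongr
        exact h1 x hx
    _ = (∫⁻ x in cube k, ‖f x‖ₑ) * ∫⁻ z in cube k, localSup (Real.sqrt d + 1) H z := by
        rw [lintegral_mul_const'' _ hf.enorm.restrict]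
    _ ≤ _ := by
        gcongr
        exact le_iSup (fun k => ∫⁻ x in cube k, ‖f x‖ₑ) k

theorem MemS0.integrable_mul_conj {f h : EuclideanSpace ℝ (Fin d) → ℂ} (hh : MemS0 h)
    (hf : AEStronglyMeasurable f volume) (hf' : localNorm f < ∞) :
    Integrable fun x => f x * conj (h x) := by
  obtain ⟨H, -, hH, hle⟩ := hh.exists_supIntegrable_bound
  refine ⟨hf.mul (memLp_conj hh.1).1, ?_⟩
  refine lt_of_le_of_lt (lintegral_mono_ae ?_) ((lintegral_mul_le_localNorm hf H).trans_lt
    (ENNReal.mul_lt_top hf' (hH _)))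
  filter_upwards [hle] with x hx
  rw [enorm_mul, RCLike.enorm_conj]
  gcongr

/-- Functions in `W(L^1, ℓ^∞)` are determined by their pairings with `S_0`. -/
theorem ae_eq_zero_of_pairing_eq_zero {f : EuclideanSpace ℝ (Fin d) → ℂ}
    (hf : AEStronglyMeasurable f volume) (hf' : localNorm f < ∞)
    (h : ∀ h, MemS0 h → pairing f h = 0) : f =ᵐ[volume] 0 := by
  -- Testing on modulated Gaussians shows that the product of `f` with the Gaussian has zero Fourier
  -- transform; the Gaussian has no zeros.
  have hi := (memS0_gaussian (d := d)).integrable_mul_conj hf hf'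
  have h0 := ae_eq_zero_of_fourier_eq_zero hi fun w => by
    have := h _ ((memS0_gaussian (d := d)).timeFreqShift 0 w)
    have h2 := windowedFourier_eq_fourier gaussian f (0, w)
    simp only [sub_zero] at h2
    rw [← h2]
    exact this
  filter_upwards [h0] with x hx
  simpa [gaussian_ne_zero] using hx

theorem pairing_add_left {f₁ f₂ h : EuclideanSpace ℝ (Fin d) → ℂ}
    (h1 : Integrable fun x => f₁ x * conj (h x)) (h2 : Integrable fun x => f₂ x * conj (h x)) :
    pairing (fun x => f₁ x + f₂ x) h = pairing f₁ h + pairing f₂ h := by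
  simp only [pairing, add_mul]
  exact integral_add h1 h2

theorem pairing_smul_left (c : ℂ) (f h : EuclideanSpace ℝ (Fin d) → ℂ) :
    pairing (fun x => c * f x) h = c * pairing f h := by
  simp only [pairing, mul_assoc]
  exact integral_const_mul _ _

variable {p q : ℝ≥0∞} [hp : Fact (1 ≤ p)] [hq : Fact (1 ≤ q)]

theorem localNorm_toFn_lt_top (f : amalgam d p q) : localNorm (toFn f) < ∞ :=
  (localNorm_le_amalgamENorm hp.out hq.out (AEEqFun.aestronglyMeasurable _)).trans_lt f.2

/-- The pairing with a function in `S_0` is a bounded linear functional. -/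
theorem MemS0.exists_pairingCLM {h : EuclideanSpace ℝ (Fin d) → ℂ} (hh : MemS0 h) :
    ∃ T : amalgam d p q →L[ℂ] ℂ, ∀ f, T f = pairing (toFn f) h := by
  obtain ⟨H, -, hH, hle⟩ := hh.exists_supIntegrable_bound
  have hint : ∀ f : amalgam d p q, Integrable fun x => toFn f x * conj (h x) := fun f =>
    hh.integrable_mul_conj (AEEqFun.aestronglyMeasurable _) (localNorm_toFn_lt_top f)
  refine ⟨LinearMap.mkContinuous
    { toFun := fun f => pairing (toFn f) h
      map_add' := fun f g => by
        rw [← pairing_add_left (hint f) (hint g)]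
        exact pairing_congr (AEEqFun.coeFn_add _ _) (Filter.EventuallyEq.refl _ _)
      map_smul' := fun c f => by
        rw [RingHom.id_apply, smul_eq_mul, ← pairing_smul_left]
        exact pairing_congr (AEEqFun.coeFn_smul _ _) (Filter.EventuallyEq.refl _ _) }
    (∫⁻ x, localSup (Real.sqrt d + 1) H x).toReal fun f => ?_, fun f => rfl⟩
  have h1 : ‖pairing (toFn f) h‖ₑ ≤ ‖f‖ₑ * ∫⁻ x, localSup (Real.sqrt d + 1) H x := by
    refine (enorm_integral_le_lintegral_enorm _).trans ?_
    calc ∫⁻ x, ‖toFn f x * conj (h x)‖ₑ ≤ ∫⁻ x, ‖toFn f x‖ₑ * H x := by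
          refine lintegral_mono_ae ?_
          filter_upwards [hle] with x hx
          rw [enorm_mul, RCLike.enorm_conj]
          gcongr
      _ ≤ localNorm (toFn f) * ∫⁻ x, localSup (Real.sqrt d + 1) H x :=
          lintegral_mul_le_localNorm (AEEqFun.aestronglyMeasurable _) H
      _ ≤ _ := by
          rw [enorm_amalgam]
          gcongr
          exact localNorm_le_amalgamENorm hp.out hq.out (AEEqFun.aestronglyMeasurable _)
  have h2 := ENNReal.toReal_mono (ENNReal.mul_lt_top enorm_lt_top (hH _)).ne h1
  rw [ENNReal.toReal_mul, toReal_enorm, toReal_enorm, mul_comm] at h2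
  exact h2

end Pairing

/-! ### The fundamental identity of Gabor analysis -/

section FundamentalIdentity

variable {d : ℕ}

theorem localSup_comp_le {X : Type*} [PseudoMetricSpace X] {R : ℝ} {F : X → ℝ≥0∞} {s : X → X}
    (hs : Isometry s) (z : X) : localSup R (fun x => F (s x)) z ≤ localSup R F (s z) :=
  localSup_le fun y hy => le_localSup (by rwa [hs.dist_eq])

theorem isometry_sub_const (t : EuclideanSpace ℝ (Fin d)) : Isometry fun x => x - t :=
  Isometry.of_dist_eq fun x y => dist_sub_right x y t

/-- This is the majorant behind every exchange of sum and integral in the unfolded Gabor series: one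
translation sum is absorbed by `F`, the other by `H`, and `G` supplies integrability. -/
theorem SupIntegrable.lattice_product {F G H : EuclideanSpace ℝ (Fin d) → ℝ≥0∞}
    (hF : SupIntegrable F) (hG : SupIntegrable G) (hH : SupIntegrable H) {a c : ℝ} (ha : 0 < a)
    (hc : 0 < c) : SupIntegrable fun x => ∑' n : (Fin d → ℤ) × (Fin d → ℤ),
      F (x - latticePoint a n.1) * (G (x + latticePoint c n.2) *
        H (x + latticePoint c n.2 - latticePoint a n.1)) := by
  intro R
  have hFm := measurable_localSup R F
  have hGm := measurable_localSup R G
  have hHm := measurable_localSup R H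
  obtain ⟨C, hC, hCle⟩ := (hF.local_sup R).exists_tsum_lattice_sub_le hc
  obtain ⟨C', hC', hCle'⟩ := (hH.local_sup R).exists_tsum_lattice_sub_le ha
  have h1 : ∀ z, localSup R (fun x => ∑' n : (Fin d → ℤ) × (Fin d → ℤ),
      F (x - latticePoint a n.1) * (G (x + latticePoint c n.2) *
        H (x + latticePoint c n.2 - latticePoint a n.1))) z ≤
      ∑' n : (Fin d → ℤ) × (Fin d → ℤ),
      localSup R F (z - latticePoint a n.1) * (localSup R G (z + latticePoint c n.2) *
        localSup R H (z + latticePoint c n.2 - latticePoint a n.1)) := by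
    intro z
    refine localSup_le fun y hy => ENNReal.tsum_le_tsum fun n => ?_
    refine mul_le_mul' (le_localSup ?_) (mul_le_mul' (le_localSup ?_) (le_localSup ?_))
    · rwa [dist_sub_right]
    · rwa [dist_add_right]
    · rwa [dist_sub_right, dist_add_right]
  -- Translating the variable moves the second index onto `F` alone, so the sum over it is a bounded
  -- periodization.
  have h2 : ∀ n : (Fin d → ℤ) × (Fin d → ℤ), ∫⁻ z, localSup R F (z - latticePoint a n.1) *
      (localSup R G (z + latticePoint c n.2) *
        localSup R H (z + latticePoint c n.2 - latticePoint a n.1)) =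
      ∫⁻ z, localSup R F (z - latticePoint a n.1 - latticePoint c n.2) *
      (localSup R G z * localSup R H (z - latticePoint a n.1)) := by
    intro n
    rw [← lintegral_sub_right_eq_self _ (latticePoint c n.2)]
    congr 1
    funext z
    rw [sub_add_cancel, sub_right_comm]
  refine (lintegral_mono h1).trans_lt ?_
  rw [lintegral_tsum fun n => by fun_prop]
  simp_rw [h2]
  rw [← lintegral_tsum fun n => by fun_prop]
  have h3 : ∀ z, ∑' n : (Fin d → ℤ) × (Fin d → ℤ),
      localSup R F (z - latticePoint a n.1 - latticePoint c n.2) *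
      (localSup R G z * localSup R H (z - latticePoint a n.1)) ≤ C * C' * localSup R G z := by
    intro z
    rw [ENNReal.tsum_prod']
    simp_rw [ENNReal.tsum_mul_right]
    calc ∑' n : Fin d → ℤ, (∑' k : Fin d → ℤ,
          localSup R F (z - latticePoint a n - latticePoint c k)) *
          (localSup R G z * localSup R H (z - latticePoint a n))
        ≤ ∑' n : Fin d → ℤ, C * (localSup R G z * localSup R H (z - latticePoint a n)) := by
          refine ENNReal.tsum_le_tsum fun n => ?_
          gcongr
          exact hCle _
      _ = C * (localSup R G z * ∑' n : Fin d → ℤ, localSup R H (z - latticePoint a n)) := by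
          rw [ENNReal.tsum_mul_left, ENNReal.tsum_mul_left]
      _ ≤ C * (localSup R G z * C') := by
          gcongr
          exact hCle' z
      _ = _ := by ring
  refine (lintegral_mono h3).trans_lt ?_
  rw [lintegral_const_mul _ hGm]
  exact ENNReal.mul_lt_top (ENNReal.mul_lt_top hC.lt_top hC'.lt_top) (hG R)

/-- The windowed Fourier transform of a function in `W(L^1, ℓ^∞)` is bounded. -/
theorem MemS0.exists_enorm_windowedFourier_le {g f : EuclideanSpace ℝ (Fin d) → ℂ} (hg : MemS0 g)
    (hf : AEStronglyMeasurable f volume) (hf' : localNorm f < ∞) :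
    ∃ C : ℝ≥0∞, C ≠ ∞ ∧ ∀ z, ‖windowedFourier g f z‖ₑ ≤ C := by
  obtain ⟨G, -, hG, hle⟩ := hg.exists_supIntegrable_bound
  refine ⟨localNorm f * ∫⁻ x, localSup (Real.sqrt d + 1) G x,
    (ENNReal.mul_lt_top hf' (hG _)).ne, fun z => ?_⟩
  refine (enorm_integral_le_lintegral_enorm _).trans ?_
  calc ∫⁻ x, ‖f x * conj (tfShift z.1 z.2 g x)‖ₑ ≤ ∫⁻ x, ‖f x‖ₑ * G (x - z.1) := by
        refine lintegral_mono_ae ?_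
        filter_upwards [(measurePreserving_sub_right volume z.1).quasiMeasurePreserving.ae hle]
          with x hx
        rw [enorm_mul, RCLike.enorm_conj, tfShift, modulateFn, enorm_mul, enorm_character, one_mul,
          translateFn]
        gcongr
    _ ≤ localNorm f * ∫⁻ x, localSup (Real.sqrt d + 1) (fun x => G (x - z.1)) x :=
        lintegral_mul_le_localNorm hf _
    _ ≤ localNorm f * ∫⁻ x, localSup (Real.sqrt d + 1) G (x - z.1) := by
        gcongr with x
        exact localSup_comp_le (isometry_sub_const z.1) x
    _ = _ := by rw [lintegral_sub_right_eq_self]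

theorem MemS0.summable_windowedFourier {g f : EuclideanSpace ℝ (Fin d) → ℂ} (hg : MemS0 g)
    (hf : MemS0 f) {a b : ℝ} (ha : 0 < a) (hb : 0 < b) :
    Summable fun n : (Fin d → ℤ) × (Fin d → ℤ) =>
      ‖windowedFourier g f (latticePoint a n.1, latticePoint b n.2)‖ :=
  tsum_enorm_ne_top_iff_summable_norm.1
    ((hf.supIntegrable_windowedFourier hg).tsum_lattice_prod_lt_top ha hb).ne

theorem pairing_tfShift_left (γ h : EuclideanSpace ℝ (Fin d) → ℂ) (t ω : EuclideanSpace ℝ (Fin d)) :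
    pairing (tfShift t ω γ) h = conj (windowedFourier γ h (t, ω)) := by
  rw [windowedFourier, pairing_conj]

/-- For `f` in `W(L^1, ℓ^∞)` the factor `F_g f` is merely bounded; all summability comes from the
samples of `F_γ h`. -/
theorem summable_gabor {f g γ h : EuclideanSpace ℝ (Fin d) → ℂ} (hg : MemS0 g) (hγ : MemS0 γ)
    (hh : MemS0 h) (hf : AEStronglyMeasurable f volume) (hf' : localNorm f < ∞) {a b : ℝ}
    (ha : 0 < a) (hb : 0 < b) : Summable fun nm : (Fin d → ℤ) × (Fin d → ℤ) =>
      windowedFourier g f (latticePoint a nm.1, latticePoint b nm.2) *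
        conj (windowedFourier γ h (latticePoint a nm.1, latticePoint b nm.2)) := by
  obtain ⟨C, hC, hle⟩ := hg.exists_enorm_windowedFourier_le hf hf'
  refine Summable.of_norm (Summable.of_nonneg_of_le (fun _ => norm_nonneg _) (fun nm => ?_)
    ((hγ.summable_windowedFourier hh ha hb).mul_left C.toReal))
  rw [norm_mul, RCLike.norm_conj]
  gcongr
  rw [← toReal_enorm]
  exact ENNReal.toReal_mono hC (hle _)

/-- Identifies the Poisson coefficients of `γ(· + t) conj g` as the coefficients in Janssen's
series. -/
theorem fourier_translate_mul_conj (γ g : EuclideanSpace ℝ (Fin d) → ℂ)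
    (t ω : EuclideanSpace ℝ (Fin d)) :
    𝓕 (fun x => γ (x + t) * conj (g x)) ω = pairing γ (translateFn t (modulateFn ω g)) := by
  rw [fourier_eq_integral_character, pairing, ← integral_add_right_eq_self
    (fun x => γ x * conj (translateFn t (modulateFn ω g) x)) t]
  congr 1
  funext x
  simp only [translateFn, modulateFn, add_sub_cancel_right, map_mul]
  ring

theorem norm_pairing_translate_modulate (γ g : EuclideanSpace ℝ (Fin d) → ℂ)
    (t ω : EuclideanSpace ℝ (Fin d)) :
    ‖pairing γ (translateFn t (modulateFn ω g))‖ = ‖windowedFourier g γ (t, ω)‖ := by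
  have : pairing γ (translateFn t (modulateFn ω g)) =
      character ω t * windowedFourier g γ (t, ω) := by
    rw [windowedFourier, pairing, pairing, ← integral_const_mul]
    congr 1
    funext x
    simp only [translateFn, modulateFn, tfShift, map_mul, conj_character, sub_eq_add_neg x t,
      character_add]
    have : character (-ω) (-t) = character ω t := by
      rw [character, character, inner_neg_neg]
    rw [this]
    ring
  rw [this, norm_mul, norm_character, one_mul]

/-- The summand obtained by unfolding the Gabor series with the Poisson summation formula. -/
def gaborTerm (f g γ h : EuclideanSpace ℝ (Fin d) → ℂ) (s t x : EuclideanSpace ℝ (Fin d)) : ℂ :=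
  f x * conj (g (x - s)) * (conj (h (x + t)) * γ (x + t - s))

theorem aestronglyMeasurable_gaborTerm {f g γ h : EuclideanSpace ℝ (Fin d) → ℂ} (hg : MemS0 g)
    (hγ : MemS0 γ) (hh : MemS0 h) (hf : AEStronglyMeasurable f volume)
    (s t : EuclideanSpace ℝ (Fin d)) :
    AEStronglyMeasurable (gaborTerm f g γ h s t) volume := by
  have hsub : ∀ {u : EuclideanSpace ℝ (Fin d) → ℂ} (t : EuclideanSpace ℝ (Fin d)),
      AEStronglyMeasurable u volume → AEStronglyMeasurable (fun x => u (x - t)) volume :=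
    fun t hu => hu.comp_measurePreserving (measurePreserving_sub_right volume t)
  have hadd : ∀ {u : EuclideanSpace ℝ (Fin d) → ℂ} (t : EuclideanSpace ℝ (Fin d)),
      AEStronglyMeasurable u volume → AEStronglyMeasurable (fun x => u (x + t)) volume :=
    fun t hu => hu.comp_measurePreserving (measurePreserving_add_right volume t)
  exact (hf.mul (hsub _ (memLp_conj hg.1).1)).mul ((hadd _ (memLp_conj hh.1).1).mul
      (hadd _ (hsub _ hγ.1.1)))

theorem tsum_lintegral_gaborTerm_lt_top {f g γ h : EuclideanSpace ℝ (Fin d) → ℂ} (hg : MemS0 g)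
    (hγ : MemS0 γ) (hh : MemS0 h) (hf : AEStronglyMeasurable f volume) (hf' : localNorm f < ∞)
    {a c : ℝ} (ha : 0 < a) (hc : 0 < c) :
    ∑' nk : (Fin d → ℤ) × (Fin d → ℤ),
      ∫⁻ x, ‖gaborTerm f g γ h (latticePoint a nk.1) (latticePoint c nk.2) x‖ₑ < ∞ := by
  obtain ⟨G, -, hG, hGle⟩ := hg.exists_supIntegrable_bound
  obtain ⟨H, -, hH, hHle⟩ := hh.exists_supIntegrable_bound
  obtain ⟨Γ, -, hΓ, hΓle⟩ := hγ.exists_supIntegrable_bound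
  have hFle : ∀ nk : (Fin d → ℤ) × (Fin d → ℤ), ∀ᵐ x,
      ‖gaborTerm f g γ h (latticePoint a nk.1) (latticePoint c nk.2) x‖ₑ ≤
      ‖f x‖ₑ * (G (x - latticePoint a nk.1) * (H (x + latticePoint c nk.2) *
        Γ (x + latticePoint c nk.2 - latticePoint a nk.1))) := by
    intro nk
    have hΓle' := (measurePreserving_sub_right volume (latticePoint a nk.1)).quasiMeasurePreserving.ae
      hΓle
    filter_upwards [
      (measurePreserving_sub_right volume (latticePoint a nk.1)).quasiMeasurePreserving.ae hGle,
      (measurePreserving_add_right volume (latticePoint c nk.2)).quasiMeasurePreserving.ae hHle,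
      (measurePreserving_add_right volume (latticePoint c nk.2)).quasiMeasurePreserving.ae
        hΓle'] with x h1 h2 h3
    simp only [gaborTerm, enorm_mul, RCLike.enorm_conj, mul_assoc]
    gcongr
  refine lt_of_le_of_lt ?_ ((lintegral_mul_le_localNorm hf _).trans_lt
    (ENNReal.mul_lt_top hf' (hG.lattice_product hH hΓ ha hc _)))
  rw [← lintegral_tsum fun nk => (aestronglyMeasurable_gaborTerm hg hγ hh hf _ _).enorm]
  refine lintegral_mono_ae ?_
  filter_upwards [ae_all_iff.2 hFle] with x hx
  rw [← ENNReal.tsum_mul_left]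
  exact ENNReal.tsum_le_tsum hx

theorem integrable_gaborTerm {f g γ h : EuclideanSpace ℝ (Fin d) → ℂ} (hg : MemS0 g)
    (hγ : MemS0 γ) (hh : MemS0 h) (hf : AEStronglyMeasurable f volume) (hf' : localNorm f < ∞)
    {a c : ℝ} (ha : 0 < a) (hc : 0 < c) (nk : (Fin d → ℤ) × (Fin d → ℤ)) :
    Integrable (gaborTerm f g γ h (latticePoint a nk.1) (latticePoint c nk.2)) :=
  ⟨aestronglyMeasurable_gaborTerm hg hγ hh hf _ _, (ENNReal.le_tsum nk).trans_lt
    (tsum_lintegral_gaborTerm_lt_top hg hγ hh hf hf' ha hc)⟩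

theorem summable_integral_norm_gaborTerm {f g γ h : EuclideanSpace ℝ (Fin d) → ℂ} (hg : MemS0 g)
    (hγ : MemS0 γ) (hh : MemS0 h) (hf : AEStronglyMeasurable f volume) (hf' : localNorm f < ∞)
    {a c : ℝ} (ha : 0 < a) (hc : 0 < c) : Summable fun nk : (Fin d → ℤ) × (Fin d → ℤ) =>
      ∫ x, ‖gaborTerm f g γ h (latticePoint a nk.1) (latticePoint c nk.2) x‖ := by
  refine (ENNReal.summable_toReal
    (tsum_lintegral_gaborTerm_lt_top hg hγ hh hf hf' ha hc).ne).congr fun nk => ?_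
  rw [integral_norm_eq_lintegral_enorm (aestronglyMeasurable_gaborTerm hg hγ hh hf _ _)]

/-- For fixed `n`, both factors are Fourier transforms sampled on `bℤ^d`, so Parseval for
periodizations applies with step `1/b`; only `h conj γ(· - na)` needs summable samples. -/
theorem tsum_modulation_eq {f g γ h : EuclideanSpace ℝ (Fin d) → ℂ} (hg : MemS0 g)
    (hγ : MemS0 γ) (hh : MemS0 h) (hf : AEStronglyMeasurable f volume) (hf' : localNorm f < ∞)
    {a b : ℝ} (ha : 0 < a) (hb : 0 < b) (n : Fin d → ℤ) :
    ∑' m : Fin d → ℤ, windowedFourier g f (latticePoint a n, latticePoint b m) *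
        conj (windowedFourier γ h (latticePoint a n, latticePoint b m)) =
      (((b ^ d : ℝ) : ℂ))⁻¹ *
        ∑' k, ∫ x, gaborTerm f g γ h (latticePoint a n) (latticePoint (1 / b) k) x := by
  have hb' : 0 < 1 / b := by positivity
  have hu : Integrable fun x => f x * conj (g (x - latticePoint a n)) := by
    have := (hg.timeFreqShift (latticePoint a n) 0).integrable_mul_conj hf hf'
    simpa [tfShift, modulateFn, translateFn, character_zero] using this
  have hv := integrable_mul_conj_translate hh.1 hγ.1 (latticePoint a n)
  have h0 : Summable fun m : Fin d → ℤ =>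
      ‖𝓕 (fun x => h x * conj (γ (x - latticePoint a n))) (latticePoint (1 / (1 / b)) m)‖ := by
    refine ((hγ.summable_windowedFourier hh ha hb).comp_injective
      (Prod.mk_right_injective n)).congr fun m => ?_
    rw [one_div_one_div, Function.comp_apply, windowedFourier_eq_fourier]
  have h1 := hasSum_fourier_mul_conj_fourier hu hv hb' h0
  simp only [one_div_one_div] at h1
  simp only [windowedFourier_eq_fourier]
  rw [h1.tsum_eq]
  have h2 := hasSum_integral_of_summable_integral_norm
    (fun k => integrable_gaborTerm hg hγ hh hf hf' ha hb' (n, k))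
    ((summable_integral_norm_gaborTerm hg hγ hh hf hf' ha hb').comp_injective
      (Prod.mk_right_injective n))
  rw [h2.tsum_eq]
  congr 1
  · simp
  · congr 1
    funext x
    rw [Complex.conj_tsum, ← tsum_mul_left]
    refine tsum_congr fun k => ?_
    simp [gaborTerm]

/-- For fixed `k`, the sum over `n` affects only `γ` and `g` and is the `aℤ^d`-periodization of `γ(·
+ ck) conj g`. Poisson summation expands it with summable coefficients, and the result is integrated
term by term. -/
theorem tsum_translation_eq {f g γ h : EuclideanSpace ℝ (Fin d) → ℂ} (hg : MemS0 g)
    (hγ : MemS0 γ) (hh : MemS0 h) (hf : AEStronglyMeasurable f volume) (hf' : localNorm f < ∞)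
    {a c : ℝ} (ha : 0 < a) (hc : 0 < c) (k : Fin d → ℤ) :
    ∑' n, ∫ x, gaborTerm f g γ h (latticePoint a n) (latticePoint c k) x =
      (((a ^ d : ℝ) : ℂ))⁻¹ * ∑' l : Fin d → ℤ,
      pairing γ (translateFn (latticePoint c k) (modulateFn (latticePoint (1 / a) l) g)) *
      pairing (translateFn (latticePoint c k) (modulateFn (latticePoint (1 / a) l) f)) h := by
  have hw : Integrable fun x => γ (x + latticePoint c k) * conj (g x) :=
    integrable_mul_conj (hγ.1.comp_measurePreserving (measurePreserving_add_right volume _)) hg.1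
  have hcs : Summable fun l : Fin d → ℤ => ‖pairing γ (translateFn (latticePoint c k)
      (modulateFn (latticePoint (1 / a) l) g))‖ := by
    have ha' : 0 < 1 / a := by positivity
    have h1 := (hg.summable_windowedFourier hγ hc ha').comp_injective (Prod.mk_right_injective k)
    refine h1.congr fun l => ?_
    rw [Function.comp_apply, norm_pairing_translate_modulate]
  have hP := ae_tsum_translate_eq hw ha (by
    simp only [fourier_translate_mul_conj]
    exact hcs)
  simp only [fourier_translate_mul_conj] at hP
  have hfk : Integrable fun x => f x * conj (h (x + latticePoint c k)) := by
    have := (hh.timeFreqShift (-latticePoint c k) 0).integrable_mul_conj hf hf'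
    simpa [tfShift, modulateFn, translateFn, character_zero] using this
  have h2 := hasSum_integral_of_summable_integral_norm
    (fun n => integrable_gaborTerm hg hγ hh hf hf' ha hc (n, k))
    ((summable_integral_norm_gaborTerm hg hγ hh hf hf' ha hc).comp_injective
      (Prod.mk_left_injective k))
  rw [h2.tsum_eq]
  -- The terms after Poisson summation; the character is written as a conjugate at the negative
  -- frequency to reuse the integrability lemma.
  let D : (Fin d → ℤ) → EuclideanSpace ℝ (Fin d) → ℂ := fun l x =>
    pairing γ (translateFn (latticePoint c k) (modulateFn (latticePoint (1 / a) l) g)) *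
      (f x * conj (h (x + latticePoint c k)) * conj (character (-latticePoint (1 / a) l) x))
  have hDi : ∀ l, Integrable (D l) := fun l => (hfk.mul_conj_character _).const_mul _
  have hD := hasSum_integral_of_summable_integral_norm hDi (by
    simp only [D, norm_mul, RCLike.norm_conj, norm_character, mul_one, integral_const_mul]
    exact hcs.mul_right _)
  have hDl : ∀ l, ∫ x, D l x =
      pairing γ (translateFn (latticePoint c k) (modulateFn (latticePoint (1 / a) l) g)) *
      pairing (translateFn (latticePoint c k) (modulateFn (latticePoint (1 / a) l) f)) h := by
    intro l
    simp only [D]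
    rw [integral_const_mul, pairing.eq_1 (translateFn _ (modulateFn _ f)),
      ← integral_add_right_eq_self (fun x => translateFn (latticePoint c k)
        (modulateFn (latticePoint (1 / a) l) f) x * conj (h x)) (latticePoint c k)]
    congr 2
    funext x
    simp only [translateFn, modulateFn, add_sub_cancel_right, conj_character, neg_neg]
    ring
  simp only [hDl] at hD
  rw [hD.tsum_eq, ← integral_const_mul]
  refine integral_congr_ae ?_
  filter_upwards [hP] with x hx
  have h3 : ∑' n : Fin d → ℤ, gaborTerm f g γ h (latticePoint a n) (latticePoint c k) x =
      f x * conj (h (x + latticePoint c k)) * ∑' n : Fin d → ℤ,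
        γ (x + latticePoint a n + latticePoint c k) * conj (g (x + latticePoint a n)) := by
    rw [← tsum_mul_left, ← (Equiv.neg (Fin d → ℤ)).tsum_eq]
    refine tsum_congr fun n => ?_
    simp only [gaborTerm, Equiv.neg_apply, latticePoint_neg, sub_neg_eq_add,
      add_right_comm x (latticePoint c k)]
    ring
  rw [h3, hx, mul_left_comm, ← tsum_mul_left]
  congr 1
  refine tsum_congr fun l => ?_
  simp only [D, conj_character, neg_neg]
  ring

/-- The fundamental identity of Gabor analysis, for `f ∈ W(L^1, ℓ^∞)`. -/
theorem hasSum_gabor {f g γ h : EuclideanSpace ℝ (Fin d) → ℂ} (hg : MemS0 g) (hγ : MemS0 γ)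
    (hh : MemS0 h) (hf : AEStronglyMeasurable f volume) (hf' : localNorm f < ∞) {a b : ℝ}
    (ha : 0 < a) (hb : 0 < b) :
    HasSum (fun nm : (Fin d → ℤ) × (Fin d → ℤ) =>
      windowedFourier g f (latticePoint a nm.1, latticePoint b nm.2) *
        conj (windowedFourier γ h (latticePoint a nm.1, latticePoint b nm.2)))
      ((((a * b) ^ d : ℝ) : ℂ)⁻¹ * ∑' k : Fin d → ℤ, ∑' l : Fin d → ℤ,
        pairing γ (translateFn (latticePoint (1 / b) k) (modulateFn (latticePoint (1 / a) l) g)) *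
        pairing (translateFn (latticePoint (1 / b) k) (modulateFn (latticePoint (1 / a) l) f)) h) := by
  have hb' : 0 < 1 / b := by positivity
  have hsum := summable_gabor hg hγ hh hf hf' ha hb
  have hIs : Summable fun nk : (Fin d → ℤ) × (Fin d → ℤ) =>
      ∫ x, gaborTerm f g γ h (latticePoint a nk.1) (latticePoint (1 / b) nk.2) x :=
    Summable.of_norm ((summable_integral_norm_gaborTerm hg hγ hh hf hf' ha hb').of_nonneg_of_le
      (fun _ => norm_nonneg _) fun nk => norm_integral_le_integral_norm _)
  -- Sum over the modulations, exchange the sums over `n` and `k`, then sum over the translations.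
  have htot := hsum.hasSum
  rw [hsum.tsum_prod] at htot
  simp only [tsum_modulation_eq hg hγ hh hf hf' ha hb, tsum_mul_left] at htot
  rw [← Summable.tsum_comm (f := fun n k =>
    ∫ x, gaborTerm f g γ h (latticePoint a n) (latticePoint (1 / b) k) x) hIs] at htot
  simp only [tsum_translation_eq hg hγ hh hf hf' ha hb', tsum_mul_left] at htot
  rwa [← mul_assoc, ← mul_inv, ← Complex.ofReal_mul, mul_comm (b ^ d), ← mul_pow] at htot

end FundamentalIdentity

/-! ### Frame-type estimates in Hilbert spaces -/

section Hilbert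

variable {H : Type*} [NormedAddCommGroup H] [InnerProductSpace ℂ H] {ι : Type*}

/-- Schur's test for the Gram matrix of a family of vectors. -/
theorem norm_sum_smul_sq_le {e : ι → H} {B : ℝ}
    (hB : ∀ (i : ι) (s : Finset ι), ∑ j ∈ s, ‖inner ℂ (e i) (e j)‖ ≤ B) (s : Finset ι) (c : ι → ℂ) :
    ‖∑ i ∈ s, c i • e i‖ ^ 2 ≤ B * ∑ i ∈ s, ‖c i‖ ^ 2 := by
  have h1 : ‖∑ i ∈ s, c i • e i‖ ^ 2 ≤
      ∑ i ∈ s, ∑ j ∈ s, ‖c i‖ * ‖c j‖ * ‖inner ℂ (e i) (e j)‖ := by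
    have h2 : ‖∑ i ∈ s, c i • e i‖ ^ 2 =
        ‖inner ℂ (∑ i ∈ s, c i • e i) (∑ i ∈ s, c i • e i)‖ := by
      rw [inner_self_eq_norm_sq_to_K]
      simp
    rw [h2, sum_inner]
    refine (norm_sum_le _ _).trans (Finset.sum_le_sum fun i _ => ?_)
    rw [inner_sum]
    refine (norm_sum_le _ _).trans (Finset.sum_le_sum fun j _ => ?_)
    rw [inner_smul_left, inner_smul_right, norm_mul, norm_mul, RCLike.norm_conj, mul_assoc]
  refine h1.trans ?_
  have h3 : ∀ i ∈ s, ∑ j ∈ s, ‖c i‖ ^ 2 * ‖inner ℂ (e i) (e j)‖ ≤ B * ‖c i‖ ^ 2 := fun i _ => by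
    rw [← Finset.mul_sum, mul_comm B]
    gcongr
    exact hB i s
  -- The modulus of the Gram matrix is symmetric, so the row bound is also a column bound.
  have h4 : ∑ i ∈ s, ∑ j ∈ s, ‖c j‖ ^ 2 * ‖inner ℂ (e i) (e j)‖ ≤ B * ∑ i ∈ s, ‖c i‖ ^ 2 := by
    rw [Finset.sum_comm, Finset.mul_sum]
    refine Finset.sum_le_sum fun j hj => ?_
    simp_rw [norm_inner_symm _ (e j)]
    exact h3 j hj
  have h5 : ∑ i ∈ s, ∑ j ∈ s, ‖c i‖ ^ 2 * ‖inner ℂ (e i) (e j)‖ ≤ B * ∑ i ∈ s, ‖c i‖ ^ 2 := by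
    rw [Finset.mul_sum]
    exact Finset.sum_le_sum h3
  calc ∑ i ∈ s, ∑ j ∈ s, ‖c i‖ * ‖c j‖ * ‖inner ℂ (e i) (e j)‖
      ≤ ∑ i ∈ s, ∑ j ∈ s, (‖c i‖ ^ 2 * ‖inner ℂ (e i) (e j)‖ / 2 +
          ‖c j‖ ^ 2 * ‖inner ℂ (e i) (e j)‖ / 2) := by
        refine Finset.sum_le_sum fun i _ => Finset.sum_le_sum fun j _ => ?_
        nlinarith [mul_nonneg (sq_nonneg (‖c i‖ - ‖c j‖)) (norm_nonneg (inner ℂ (e i) (e j)))]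
    _ = (∑ i ∈ s, ∑ j ∈ s, ‖c i‖ ^ 2 * ‖inner ℂ (e i) (e j)‖) / 2 +
          (∑ i ∈ s, ∑ j ∈ s, ‖c j‖ ^ 2 * ‖inner ℂ (e i) (e j)‖) / 2 := by
        simp_rw [Finset.sum_add_distrib, Finset.sum_div]
    _ ≤ _ := by linarith

/-- Bessel's inequality for a family of vectors with row-bounded Gram matrix. -/
theorem sum_norm_inner_sq_le {e : ι → H} {B : ℝ} (hB0 : 0 ≤ B)
    (hB : ∀ (i : ι) (s : Finset ι), ∑ j ∈ s, ‖inner ℂ (e i) (e j)‖ ≤ B) (s : Finset ι) (f : H) :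
    ∑ i ∈ s, ‖inner ℂ (e i) f‖ ^ 2 ≤ B * ‖f‖ ^ 2 := by
  set A := ∑ i ∈ s, ‖inner ℂ (e i) f‖ ^ 2 with hA
  have hA0 : 0 ≤ A := Finset.sum_nonneg fun _ _ => sq_nonneg _
  -- Pairing `v` with `f` returns `A`, while Schur's test gives `‖v‖² ≤ B A`; Cauchy–Schwarz
  -- combines the two and one factor `A` cancels.
  let v := ∑ i ∈ s, inner ℂ (e i) f • e i
  have h1 : A ≤ ‖v‖ * ‖f‖ := by
    have h2 : inner ℂ v f = (A : ℂ) := by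
      simp only [v, sum_inner, inner_smul_left, hA]
      push_cast
      refine Finset.sum_congr rfl fun i _ => ?_
      exact RCLike.conj_mul _
    have h3 := norm_inner_le_norm (𝕜 := ℂ) v f
    rwa [h2, Complex.norm_real, Real.norm_of_nonneg hA0] at h3
  have h4 : ‖v‖ ^ 2 ≤ B * A := norm_sum_smul_sq_le hB s _
  rcases hA0.eq_or_lt with h | h
  · rw [← h]
    positivity
  · have h5 : A * A ≤ A * (B * ‖f‖ ^ 2) := by
      calc A * A ≤ (‖v‖ * ‖f‖) * (‖v‖ * ‖f‖) := by gcongr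
        _ = ‖v‖ ^ 2 * ‖f‖ ^ 2 := by ring
        _ ≤ (B * A) * ‖f‖ ^ 2 := by gcongr
        _ = _ := by ring
    exact le_of_mul_le_mul_left h5 h

/-- Bessel's inequality for `e` makes the coefficients square summable, and Schur's test for `e'`
turns small coefficient tails into small vectors, uniformly over finite sets. -/
theorem summable_inner_smul [CompleteSpace H] {e e' : ι → H} {B B' : ℝ} (hB0 : 0 ≤ B) (hB0' : 0 ≤ B')
    (hB : ∀ (i : ι) (s : Finset ι), ∑ j ∈ s, ‖inner ℂ (e i) (e j)‖ ≤ B)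
    (hB' : ∀ (i : ι) (s : Finset ι), ∑ j ∈ s, ‖inner ℂ (e' i) (e' j)‖ ≤ B') (f : H) :
    Summable fun i => inner ℂ (e i) f • e' i := by
  have h1 : Summable fun i => ‖inner ℂ (e i) f‖ ^ 2 :=
    summable_of_sum_le (fun _ => sq_nonneg _) fun s => sum_norm_inner_sq_le hB0 hB s f
  rw [summable_iff_vanishing_norm] at h1 ⊢
  intro ε hε
  -- The added one covers `B' = 0` and keeps the final inequality strict.
  obtain ⟨s, hs⟩ := h1 (ε ^ 2 / (B' + 1)) (by positivity)
  refine ⟨s, fun t ht => ?_⟩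
  have h2 := hs t ht
  rw [Real.norm_of_nonneg (Finset.sum_nonneg fun _ _ => sq_nonneg _), lt_div_iff₀ (by positivity)]
    at h2
  have h3 := norm_sum_smul_sq_le hB' t fun i => inner ℂ (e i) f
  have h4 : 0 ≤ ∑ i ∈ t, ‖inner ℂ (e i) f‖ ^ 2 := Finset.sum_nonneg fun _ _ => sq_nonneg _
  refine lt_of_pow_lt_pow_left₀ 2 hε.le ?_
  nlinarith

end Hilbert

/-! ### Convergence of the Gabor series in `L²` -/

section LTwo

variable {d : ℕ}

theorem amalgamENorm_two (f : EuclideanSpace ℝ (Fin d) → ℂ) :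
    amalgamENorm 2 2 f = eLpNorm f 2 volume := by
  unfold amalgamENorm
  rw [eLpNorm_eq_lintegral_rpow_enorm_toReal two_ne_zero ENNReal.ofNat_ne_top,
    eLpNorm_eq_lintegral_rpow_enorm_toReal two_ne_zero ENNReal.ofNat_ne_top, lintegral_count,
    lintegral_eq_tsum_cube]
  congr 1
  refine tsum_congr fun k => ?_
  rw [enorm_eq_self, eLpNorm_indicator_eq_eLpNorm_restrict (measurableSet_cube k),
    eLpNorm_eq_lintegral_rpow_enorm_toReal two_ne_zero ENNReal.ofNat_ne_top, ← ENNReal.rpow_mul]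
  simp

theorem inner_toLp_eq_pairing {f g : EuclideanSpace ℝ (Fin d) → ℂ} (hf : MemLp f 2)
    (hg : MemLp g 2) : inner ℂ (hg.toLp g) (hf.toLp f) = pairing f g := by
  rw [L2.inner_def, pairing]
  refine integral_congr_ae ?_
  filter_upwards [hf.coeFn_toLp, hg.coeFn_toLp] with x h1 h2
  rw [h1, h2]
  rfl

/-- Up to phase the Gram matrix is a convolution matrix: its entries depend on `i - j` through
lattice samples of `F_g g`, which are summable. -/
theorem MemS0.exists_sum_gram_le {g : EuclideanSpace ℝ (Fin d) → ℂ} (hg : MemS0 g) {a b : ℝ}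
    (ha : 0 < a) (hb : 0 < b) : ∃ B : ℝ, 0 ≤ B ∧ ∀ (i : (Fin d → ℤ) × (Fin d → ℤ))
      (s : Finset ((Fin d → ℤ) × (Fin d → ℤ))),
      ∑ j ∈ s, ‖inner ℂ
        ((memLp_tfShift hg.1 (latticePoint a i.1) (latticePoint b i.2)).toLp _)
        ((memLp_tfShift hg.1 (latticePoint a j.1) (latticePoint b j.2)).toLp _)‖ ≤ B := by
  set W : (Fin d → ℤ) × (Fin d → ℤ) → ℝ := fun n =>
    ‖windowedFourier g g (latticePoint a n.1, latticePoint b n.2)‖ with hW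
  have hs : Summable W := hg.summable_windowedFourier hg ha hb
  have hW0 : ∀ n, 0 ≤ W n := fun n => norm_nonneg _
  clear_value W
  refine ⟨∑' n, W n, tsum_nonneg hW0, fun i s => ?_⟩
  have h1 : ∀ j : (Fin d → ℤ) × (Fin d → ℤ), ‖inner ℂ
        ((memLp_tfShift hg.1 (latticePoint a i.1) (latticePoint b i.2)).toLp _)
        ((memLp_tfShift hg.1 (latticePoint a j.1) (latticePoint b j.2)).toLp _)‖ =
      W (i - j) := by
    intro j
    rw [hW, inner_toLp_eq_pairing]
    have h2 := norm_windowedFourier_tfShift g g (latticePoint a j.1, latticePoint b j.2) (0, 0)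
      (latticePoint a i.1, latticePoint b i.2)
    have h3 : tfShift 0 0 g = g := by
      funext x
      simp [tfShift, modulateFn, translateFn, character_zero]
    rw [h3] at h2
    simp only []
    rw [Prod.fst_sub, Prod.snd_sub, latticePoint_sub, latticePoint_sub]
    rw [Prod.mk_zero_zero, add_zero, Prod.mk_sub_mk] at h2
    exact h2
  rw [Finset.sum_congr rfl fun j _ => h1 j]
  have h4 : Summable fun j => W (i - j) := (Equiv.subLeft i).summable_iff.2 hs
  have h5 : ∑' j, W (i - j) = ∑' n, W n := (Equiv.subLeft i).tsum_eq W
  rw [← h5]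
  exact h4.sum_le_tsum s fun _ _ => hW0 _

theorem coeFn_Lp_sum {ι : Type*} (s : Finset ι) (f : ι → Lp ℂ 2 (volume : Measure
    (EuclideanSpace ℝ (Fin d)))) : (∑ i ∈ s, f i : Lp ℂ 2 volume) =ᵐ[volume]
      fun x => ∑ i ∈ s, f i x := by
  classical
  induction s using Finset.induction_on with
  | empty =>
    simp only [Finset.sum_empty]
    exact Lp.coeFn_zero _ _ _
  | insert i s hi ih =>
    rw [Finset.sum_insert hi]
    filter_upwards [ih, Lp.coeFn_add (f i) (∑ j ∈ s, f j)] with x h1 h2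
    rw [h2, Pi.add_apply, h1, Finset.sum_insert hi]

end LTwo

/-! ### Janssen's representation -/

section Janssen

variable {d : ℕ} {p q : ℝ≥0∞} [hp : Fact (1 ≤ p)] [hq : Fact (1 ≤ q)]

theorem norm_translationOp_le (x : EuclideanSpace ℝ (Fin d)) : ‖translationOp p q x‖ ≤ 2 ^ d :=
  LinearMap.mkContinuous_norm_le _ (by positivity) _

theorem norm_modulationOp_le (ω : EuclideanSpace ℝ (Fin d)) : ‖modulationOp p q ω‖ ≤ 1 :=
  LinearMap.mkContinuous_norm_le _ zero_le_one _

theorem toFn_translationOp (x : EuclideanSpace ℝ (Fin d)) (f : amalgam d p q) :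
    toFn (translationOp p q x f) =ᵐ[volume] translateFn x (toFn f) :=
  AEEqFun.coeFn_mk _ _

theorem toFn_modulationOp (ω : EuclideanSpace ℝ (Fin d)) (f : amalgam d p q) :
    toFn (modulationOp p q ω f) =ᵐ[volume] modulateFn ω (toFn f) :=
  AEEqFun.coeFn_mk _ _

theorem toFn_translationOp_modulationOp (x ω : EuclideanSpace ℝ (Fin d)) (f : amalgam d p q) :
    toFn (translationOp p q x (modulationOp p q ω f)) =ᵐ[volume]
      translateFn x (modulateFn ω (toFn f)) :=
  (toFn_translationOp x _).trans (translate_congr (toFn_modulationOp ω f) x)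

theorem modulateFn_translateFn (x ω : EuclideanSpace ℝ (Fin d))
    (f : EuclideanSpace ℝ (Fin d) → ℂ) :
    modulateFn ω (translateFn x f) = fun t =>
      character ω x * translateFn x (modulateFn ω f) t := by
  funext t
  simp only [modulateFn, translateFn]
  rw [← mul_assoc, ← character_add, add_sub_cancel]

theorem modulationOp_comp_translationOp (x ω : EuclideanSpace ℝ (Fin d)) :
    (modulationOp p q ω).comp (translationOp p q x) =
      character ω x • (translationOp p q x).comp (modulationOp p q ω) := by
  refine ContinuousLinearMap.ext fun f => Subtype.ext (AEEqFun.ext ?_)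
  have h1 := (toFn_modulationOp (p := p) (q := q) ω (translationOp p q x f)).trans
    (modulate_congr (toFn_translationOp x f) ω)
  rw [modulateFn_translateFn] at h1
  refine h1.trans ?_
  have h2 := AEEqFun.coeFn_smul (character ω x)
    (translationOp p q x (modulationOp p q ω f) : EuclideanSpace ℝ (Fin d) →ₘ[volume] ℂ)
  filter_upwards [h2, toFn_translationOp_modulationOp x ω f] with t h3 h4
  rw [← h4]
  exact h3.symm

theorem pairing_smul_right (c : ℂ) (f h : EuclideanSpace ℝ (Fin d) → ℂ) :
    pairing f (fun x => c * h x) = conj c * pairing f h := by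
  simp only [pairing, map_mul, mul_left_comm _ (conj c)]
  exact integral_const_mul _ _

/-- Commuting the two shifts produces a phase in the operator and its conjugate in the coefficient,
and these cancel. The two Janssen series thus have the same terms. -/
theorem pairing_smul_modulationOp_translationOp (γ g : EuclideanSpace ℝ (Fin d) → ℂ)
    (x ω : EuclideanSpace ℝ (Fin d)) :
    pairing γ (modulateFn ω (translateFn x g)) •
        (modulationOp p q ω).comp (translationOp p q x) =
      pairing γ (translateFn x (modulateFn ω g)) •
        (translationOp p q x).comp (modulationOp p q ω) := by
  rw [modulateFn_translateFn, pairing_smul_right, modulationOp_comp_translationOp, smul_smul]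
  congr 1
  rw [mul_right_comm, RCLike.conj_mul, norm_character]
  simp

/-- The factor `2 ^ d` bounds every translation uniformly, so the operator norms do not disturb the
summability of the coefficients. -/
theorem summable_norm_janssen {g γ : EuclideanSpace ℝ (Fin d) → ℂ} (hg : MemS0 g) (hγ : MemS0 γ)
    {a b : ℝ} (ha : 0 < a) (hb : 0 < b) :
    Summable fun kn : (Fin d → ℤ) × (Fin d → ℤ) =>
        ‖pairing γ (translateFn (latticePoint (1 / b) kn.1)
              (modulateFn (latticePoint (1 / a) kn.2) g)) •
          ((translationOp p q (latticePoint (1 / b) kn.1)).comp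
            (modulationOp p q (latticePoint (1 / a) kn.2)))‖ := by
  have ha' : 0 < 1 / a := by positivity
  have hb' : 0 < 1 / b := by positivity
  refine Summable.of_nonneg_of_le (fun _ => norm_nonneg _) (fun kn => ?_)
    ((hg.summable_windowedFourier hγ hb' ha').mul_right (2 ^ d))
  rw [norm_smul, norm_pairing_translate_modulate]
  refine mul_le_mul_of_nonneg_left ?_ (norm_nonneg _)
  refine (ContinuousLinearMap.opNorm_comp_le _ _).trans ?_
  calc _ ≤ (2 : ℝ) ^ d * 1 := mul_le_mul (norm_translationOp_le _) (norm_modulationOp_le _)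
        (norm_nonneg _) (by positivity)
    _ = 2 ^ d := mul_one _

/-- Elements of the amalgam spaces are determined by their pairings with `S_0`. -/
theorem amalgam_ext {f₁ f₂ : amalgam d p q}
    (h : ∀ h, MemS0 h → pairing (toFn f₁) h = pairing (toFn f₂) h) : f₁ = f₂ := by
  rw [← sub_eq_zero]
  refine Subtype.ext (AEEqFun.ext ?_)
  refine (ae_eq_zero_of_pairing_eq_zero (AEEqFun.aestronglyMeasurable _)
    (localNorm_toFn_lt_top (f₁ - f₂)) fun u hu => ?_).trans AEEqFun.coeFn_zero.symm
  obtain ⟨T, hT⟩ := hu.exists_pairingCLM (p := p) (q := q)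
  have h1 : T (f₁ - f₂) = 0 := by rw [map_sub, hT, hT, h u hu, sub_self]
  rwa [hT] at h1

theorem IsGaborFrameOperator.unique {g γ : EuclideanSpace ℝ (Fin d) → ℂ} {a b : ℝ}
    {S S' : amalgam d p q →L[ℂ] amalgam d p q} (h : IsGaborFrameOperator a b g γ S)
    (h' : IsGaborFrameOperator a b g γ S') : S = S' :=
  ContinuousLinearMap.ext fun f => amalgam_ext fun u hu => (h f u hu).unique (h' f u hu)

theorem IsGaborFrameOperator.eq_gaborFrameOperator {g γ : EuclideanSpace ℝ (Fin d) → ℂ} {a b : ℝ}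
    {S : amalgam d p q →L[ℂ] amalgam d p q} (h : IsGaborFrameOperator a b g γ S) :
    S = gaborFrameOperator p q a b g γ := by
  have h1 : ∃ S : amalgam d p q →L[ℂ] amalgam d p q, IsGaborFrameOperator a b g γ S := ⟨S, h⟩
  rw [gaborFrameOperator, dif_pos h1]
  exact h.unique h1.choose_spec

theorem hasSum_of_eq_swap {α β E : Type*} [AddCommMonoid E] [TopologicalSpace E]
    {F : α × β → E} {G : β × α → E} {s : E} (h : HasSum F s) (hG : ∀ x, G x = F x.swap) :
    HasSum G s :=
  ((Equiv.prodComm β α).hasSum_iff.2 h).congr_fun hG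

theorem eq_mul_tsum_tsum_of_hasSum {α β : Type*} {c S : ℂ} {F : α × β → ℂ}
    (h : HasSum (fun x => c * F x) S) : S = c * ∑' k, ∑' l, F (k, l) := by
  rw [← h.tsum_eq, h.summable.tsum_prod]
  simp_rw [tsum_mul_left]

/-- The sum of Janssen's series is the Gabor frame operator. -/
theorem isGaborFrameOperator_of_hasSum {g γ : EuclideanSpace ℝ (Fin d) → ℂ} (hg : MemS0 g)
    (hγ : MemS0 γ) {a b : ℝ} (ha : 0 < a) (hb : 0 < b) {S : amalgam d p q →L[ℂ] amalgam d p q}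
    (hS : HasSum (fun kn : (Fin d → ℤ) × (Fin d → ℤ) =>
        (1 / pairing γ g) • pairing γ
            (translateFn (latticePoint (1 / b) kn.1)
              (modulateFn (latticePoint (1 / a) kn.2) g)) •
          ((translationOp p q (latticePoint (1 / b) kn.1)).comp
            (modulationOp p q (latticePoint (1 / a) kn.2)))) S) :
    IsGaborFrameOperator a b g γ S := by
  intro f u hu
  have hm : AEStronglyMeasurable (toFn f) volume := AEEqFun.aestronglyMeasurable _
  obtain ⟨T, hT⟩ := hu.exists_pairingCLM (p := p) (q := q)
  -- Evaluation at `f` and pairing with `u` are continuous and linear, so they pass through the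
  -- operator-norm sum.
  have h1 := (hS.mapL (ContinuousLinearMap.apply ℂ (amalgam d p q) f)).mapL T
  have h2 : HasSum (fun kn : (Fin d → ℤ) × (Fin d → ℤ) => (1 / pairing γ g) *
      (pairing γ (translateFn (latticePoint (1 / b) kn.1)
        (modulateFn (latticePoint (1 / a) kn.2) g)) *
      pairing (translateFn (latticePoint (1 / b) kn.1)
        (modulateFn (latticePoint (1 / a) kn.2) (toFn f))) u)) (pairing (toFn (S f)) u) := by
    have h3 : T (ContinuousLinearMap.apply ℂ (amalgam d p q) f S) = pairing (toFn (S f)) u := hT _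
    rw [h3] at h1
    have h5 : ∀ (c k z : ℂ) (A : amalgam d p q →L[ℂ] amalgam d p q), T (A f) = z →
        c * (k * z) = T (ContinuousLinearMap.apply ℂ (amalgam d p q) f (c • k • A)) := by
      rintro c k _ A rfl
      simp
    refine h1.congr_fun fun kn => ?_
    have h4 : T (translationOp p q (latticePoint (1 / b) kn.1)
        (modulationOp p q (latticePoint (1 / a) kn.2) f)) =
        pairing (translateFn (latticePoint (1 / b) kn.1)
          (modulateFn (latticePoint (1 / a) kn.2) (toFn f))) u :=
      (hT _).trans (pairing_congr (toFn_translationOp_modulationOp _ _ f)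
        (Filter.EventuallyEq.refl _ _))
    exact h5 _ _ _ _ h4
  have h4 := hasSum_gabor hg hγ hu hm (localNorm_toFn_lt_top f) ha hb
  have h5 := eq_mul_tsum_tsum_of_hasSum (F := fun kn : (Fin d → ℤ) × (Fin d → ℤ) =>
    pairing γ (translateFn (latticePoint (1 / b) kn.1)
        (modulateFn (latticePoint (1 / a) kn.2) g)) *
      pairing (translateFn (latticePoint (1 / b) kn.1)
        (modulateFn (latticePoint (1 / a) kn.2) (toFn f))) u) h2
  have hab : (((a * b) ^ d : ℝ) : ℂ) ≠ 0 := by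
    exact_mod_cast (pow_pos (mul_pos ha hb) d).ne'
  -- The normalization `(ab)^d` cancels the inverse covolume factor of the fundamental identity.
  have h6 := h4.mul_left ((((a * b) ^ d : ℝ) : ℂ) / pairing γ g)
  rw [← mul_assoc, div_mul_eq_mul_div, mul_inv_cancel₀ hab, ← h5] at h6
  refine h6.congr_fun fun nm => ?_
  rw [pairing_tfShift_left]
  rfl

/-- The Gabor series converges unconditionally in `L²`. -/
theorem tendsto_eLpNorm_gabor {g γ : EuclideanSpace ℝ (Fin d) → ℂ} (hg : MemS0 g)
    (hγ : MemS0 γ) {a b : ℝ} (ha : 0 < a) (hb : 0 < b) {S : amalgam d 2 2 →L[ℂ] amalgam d 2 2}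
    (hS : IsGaborFrameOperator a b g γ S) (f : amalgam d 2 2) :
    Filter.Tendsto (fun F : Finset ((Fin d → ℤ) × (Fin d → ℤ)) =>
      eLpNorm (toFn (S f) - ((((a * b) ^ d : ℝ) : ℂ) / pairing γ g) • ∑ nm ∈ F,
        pairing (toFn f) (tfShift (latticePoint a nm.1) (latticePoint b nm.2) g) •
          tfShift (latticePoint a nm.1) (latticePoint b nm.2) γ) 2 volume)
      Filter.atTop (nhds 0) := by
  set c : ℂ := (((a * b) ^ d : ℝ) : ℂ) / pairing γ g
  have hf : MemLp (toFn f) 2 volume :=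
    ⟨AEEqFun.aestronglyMeasurable _, (amalgamENorm_two (toFn f)).symm.trans_lt f.2⟩
  have hgm : ∀ nm : (Fin d → ℤ) × (Fin d → ℤ),
      MemLp (tfShift (latticePoint a nm.1) (latticePoint b nm.2) g) 2 volume := fun nm =>
    memLp_tfShift hg.1 _ _
  have hγm : ∀ nm : (Fin d → ℤ) × (Fin d → ℤ),
      MemLp (tfShift (latticePoint a nm.1) (latticePoint b nm.2) γ) 2 volume := fun nm =>
    memLp_tfShift hγ.1 _ _
  obtain ⟨B, hB0, hB⟩ := hg.exists_sum_gram_le ha hb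
  obtain ⟨B', hB0', hB'⟩ := hγ.exists_sum_gram_le ha hb
  have hsum : Summable fun nm => inner ℂ ((hgm nm).toLp _) (hf.toLp _) • (hγm nm).toLp _ :=
    summable_inner_smul hB0 hB0' hB hB' (hf.toLp _)
  simp only [inner_toLp_eq_pairing] at hsum
  obtain ⟨s, hs⟩ := hsum
  have hmem : amalgamENorm 2 2 ((c • s : Lp ℂ 2 volume) :
      EuclideanSpace ℝ (Fin d) →ₘ[volume] ℂ) < ∞ := by
    rw [amalgamENorm_two]
    exact (Lp.memLp (c • s)).2
  -- Norm convergence implies weak convergence, so the `L²` sum has the same pairings with `S_0` as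
  -- `S f`, and `S_0` separates points.
  have hSf : S f = ⟨((c • s : Lp ℂ 2 volume) : EuclideanSpace ℝ (Fin d) →ₘ[volume] ℂ), hmem⟩ := by
    refine amalgam_ext fun u hu => ?_
    have h1 := (hs.const_smul c).mapL (innerSL ℂ (hu.1.toLp u))
    have h2 : innerSL ℂ (hu.1.toLp u) (c • s) =
        pairing (toFn ⟨((c • s : Lp ℂ 2 volume) : EuclideanSpace ℝ (Fin d) →ₘ[volume] ℂ), hmem⟩)
          u := by
      have h3 := inner_toLp_eq_pairing (Lp.memLp (c • s)) hu.1
      rwa [Lp.toLp_coeFn] at h3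
    rw [h2] at h1
    refine (hS f u hu).unique (h1.congr_fun fun nm => ?_)
    rw [innerSL_apply_apply, inner_smul_right, inner_smul_right, inner_toLp_eq_pairing]
  have h1 : Filter.Tendsto (fun F : Finset ((Fin d → ℤ) × (Fin d → ℤ)) =>
      ‖c • s - c • ∑ nm ∈ F, pairing (toFn f)
        (tfShift (latticePoint a nm.1) (latticePoint b nm.2) g) • (hγm nm).toLp _‖ₑ)
      Filter.atTop (nhds 0) := by
    have h2 := ((Filter.Tendsto.const_smul hs c).const_sub (c • s)).enorm
    rwa [sub_self, enorm_zero] at h2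
  refine h1.congr fun F => ?_
  rw [Lp.enorm_def]
  refine eLpNorm_congr_ae ?_
  rw [hSf]
  have h3 : ∀ᵐ x, ∀ nm ∈ F, (pairing (toFn f)
      (tfShift (latticePoint a nm.1) (latticePoint b nm.2) g) • (hγm nm).toLp _ : Lp ℂ 2 volume) x
      = pairing (toFn f) (tfShift (latticePoint a nm.1) (latticePoint b nm.2) g) •
        tfShift (latticePoint a nm.1) (latticePoint b nm.2) γ x := by
    refine (ae_ball_iff F.countable_toSet).2 fun nm _ => ?_
    filter_upwards [Lp.coeFn_smul (pairing (toFn f)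
      (tfShift (latticePoint a nm.1) (latticePoint b nm.2) g)) ((hγm nm).toLp _),
      (hγm nm).coeFn_toLp] with x h4 h5
    rw [h4, Pi.smul_apply, h5]
  filter_upwards [h3, Lp.coeFn_sub (c • s) (c • ∑ nm ∈ F, pairing (toFn f)
        (tfShift (latticePoint a nm.1) (latticePoint b nm.2) g) • (hγm nm).toLp _),
    Lp.coeFn_smul c (∑ nm ∈ F, pairing (toFn f)
        (tfShift (latticePoint a nm.1) (latticePoint b nm.2) g) • (hγm nm).toLp _),
    coeFn_Lp_sum F fun nm => pairing (toFn f)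
        (tfShift (latticePoint a nm.1) (latticePoint b nm.2) g) • (hγm nm).toLp _]
    with x h4 h5 h6 h7
  rw [h5, Pi.sub_apply, h6, Pi.smul_apply, h7, Finset.sum_congr rfl h4]
  simp only [Pi.sub_apply, Pi.smul_apply, Finset.sum_apply]

end Janssen

end GaborJanssen

end

theorem mainTheorem3 (d : ℕ) (hd : 1 ≤ d) (p q : ℝ≥0∞) [Fact (1 ≤ p)] [Fact (1 ≤ q)]
    (g γ : EuclideanSpace ℝ (Fin d) → ℂ)
    (hg : MemS0 g) (hγ : MemS0 γ)
    (hgγ : pairing γ g ≠ 0) (a b : ℝ) (ha : 0 < a) (hb : 0 < b) :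
    (IsGaborFrameOperator a b g γ (gaborFrameOperator p q a b g γ) ∧
      (∀ S : amalgam d p q →L[ℂ] amalgam d p q,
        IsGaborFrameOperator a b g γ S →
          S = gaborFrameOperator p q a b g γ) ∧
      (p = 2 → q = 2 → ∀ f : amalgam d p q,
        Filter.Tendsto
          (fun F : Finset ((Fin d → ℤ) × (Fin d → ℤ)) =>
            eLpNorm (toFn (gaborFrameOperator p q a b g γ f) -
              ((((a * b) ^ d : ℝ) : ℂ) / pairing γ g) • ∑ nm ∈ F,
                pairing (toFn f)
                    (tfShift (latticePoint a nm.1)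
                      (latticePoint b nm.2) g) •
                  tfShift (latticePoint a nm.1)
                    (latticePoint b nm.2) γ) 2 volume)
          Filter.atTop (nhds 0))) ∧
    (Summable (fun ln : (Fin d → ℤ) × (Fin d → ℤ) =>
        ‖pairing γ
            (modulateFn (latticePoint (1 / a) ln.1)
              (translateFn (latticePoint (1 / b) ln.2) g)) •
          ((modulationOp p q (latticePoint (1 / a) ln.1)).comp
            (translationOp p q (latticePoint (1 / b) ln.2)))‖) ∧
      HasSum (fun ln : (Fin d → ℤ) × (Fin d → ℤ) =>
        (1 / pairing γ g) • pairing γ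
            (modulateFn (latticePoint (1 / a) ln.1)
              (translateFn (latticePoint (1 / b) ln.2) g)) •
          ((modulationOp p q (latticePoint (1 / a) ln.1)).comp
            (translationOp p q (latticePoint (1 / b) ln.2))))
        (gaborFrameOperator p q a b g γ)) ∧
    (Summable (fun kn : (Fin d → ℤ) × (Fin d → ℤ) =>
        ‖pairing γ
            (translateFn (latticePoint (1 / b) kn.1)
              (modulateFn (latticePoint (1 / a) kn.2) g)) •
          ((translationOp p q (latticePoint (1 / b) kn.1)).comp
            (modulationOp p q (latticePoint (1 / a) kn.2)))‖) ∧
      HasSum (fun kn : (Fin d → ℤ) × (Fin d → ℤ) =>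
        (1 / pairing γ g) • pairing γ
            (translateFn (latticePoint (1 / b) kn.1)
              (modulateFn (latticePoint (1 / a) kn.2) g)) •
          ((translationOp p q (latticePoint (1 / b) kn.1)).comp
            (modulationOp p q (latticePoint (1 / a) kn.2))))
        (gaborFrameOperator p q a b g γ)) := by
  have hsum := summable_norm_janssen (p := p) (q := q) hg hγ ha hb
  -- The operator is constructed as the sum of Janssen's series; completeness of the amalgam space
  -- enters here.
  obtain ⟨S, hS⟩ := (Summable.of_norm hsum).const_smul (1 / pairing γ g)
  have hG := isGaborFrameOperator_of_hasSum hg hγ ha hb hS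
  have hSeq := hG.eq_gaborFrameOperator
  rw [← hSeq]
  refine ⟨⟨hG, fun S' hS' => hS'.unique hG, ?_⟩, ⟨?_, ?_⟩, hsum, hS⟩
  · intro hp hq f
    subst hp hq
    exact tendsto_eLpNorm_gabor hg hγ ha hb hG f
  · refine (hasSum_of_eq_swap hsum.hasSum fun ln => ?_).summable
    exact congrArg norm (pairing_smul_modulationOp_translationOp γ g _ _)
  · refine hasSum_of_eq_swap hS fun ln => ?_
    exact congrArg _ (pairing_smul_modulationOp_translationOp γ g _ _)
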